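/- Let $0<d^-\le d^+<\infty$ and let $p\in(1,\infty]$ satisfy $p>\max\{1,1/d^-\}$. There exist constants $\delta>0$ and $C>0$, depending only on $d^-$, $d^+$ and $p$, such that the following holds. Let $(d_j)_{j\ge1}$ be real numbers with $d^-\le d_j\le d^+$ for all $j\ge 1$, let $(\hat f(j))_{j\ge1}$ be complex numbers, and put \[ \rho=\rho(p)=\Bigl(\sum_{j=1}^\infty\frac{|\hat f(j)-1|^p}{j}\Bigr)^{1/p}\quad(p<\infty),\qquad \rho=\rho(\infty)=\sup_{j\ge1}|\hat f(j)-1|\quad(p=\infty). \] Define $p_n$ and $M_n$ as the power series coefficients \[ \sum_{n=0}^\infty p_nz^n=\exp\Bigl\{\sum_{j=1}^\infty\frac{d_j}{j}z^j\Bigr\},\qquad \sum_{n=0}^\infty M_nz^n=\exp\Bigl\{\sum_{j=1}^\infty\frac{d_j\hat f(j)}{j}z^j\Bigr\}, \] and let \[ m(z)=\exp\Bigl\{\sum_{j=1}^\infty d_j\,\frac{\hat f(j)-1}{j}\,z^j\Bigr\}. \] If $\rho\le\delta$, then the series in the definition of $m(z)$ converges absolutely for $|z|<1$, and for every $n\ge1$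 \[ \frac{M_n}{p_n}=m(e^{-1/n})\,(1+r_n)\qquad\text{with}\quad |r_n|\le C\rho . \] -/

import Mathlib

open scoped ENNReal

noncomputable section

namespace MeanValue

/-- The Taylor coefficient `[z^n] exp {∑_{j ≥ 1} (a_j / j) z^j}`. The value `a 0` is not used. -/
def expCoeff (a : ℕ → ℂ) (n : ℕ) : ℂ :=
  PowerSeries.coeff n
    ((PowerSeries.exp ℂ).subst
      (PowerSeries.mk fun j : ℕ => if j = 0 then (0 : ℂ) else a j / (j : ℂ)))

/-- `p_n = [z^n] exp {∑_{j ≥ 1} (d_j / j) z^j}`. -/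
def pCoeff (d : ℕ → ℝ) (n : ℕ) : ℂ :=
  expCoeff (fun j => (d j : ℂ)) n

/-- `M_n = [z^n] exp {∑_{j ≥ 1} (d_j f_j / j) z^j}`. -/
def MCoeff (d : ℕ → ℝ) (f : ℕ → ℂ) (n : ℕ) : ℂ :=
  expCoeff (fun j => (d j : ℂ) * f j) n

/-- The summand of index `j + 1` of the series `L(z) = ∑_{j ≥ 1} d_j ((f_j - 1) / j) z^j`. -/
def LTerm (d : ℕ → ℝ) (f : ℕ → ℂ) (z : ℂ) (j : ℕ) : ℂ :=
  (d (j + 1) : ℂ) * ((f (j + 1) - 1) / ((j + 1 : ℕ) : ℂ)) * z ^ (j + 1)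

/-- `m(z) = exp {∑_{j ≥ 1} d_j ((f_j - 1) / j) z^j}`. -/
def mFun (d : ℕ → ℝ) (f : ℕ → ℂ) (z : ℂ) : ℂ :=
  Complex.exp (∑' j : ℕ, LTerm d f z j)

/-- `ρ(p) = (∑_{j ≥ 1} |f_j - 1|^p / j)^{1/p}` for finite `p`, and
`ρ(∞) = sup_{j ≥ 1} |f_j - 1|`; the value is `∞` if the series diverges
(respectively, if the sequence is unbounded). -/
def rho (f : ℕ → ℂ) (p : ℝ≥0∞) : ℝ≥0∞ :=
  if p = ∞ then ⨆ j : ℕ, ‖f (j + 1) - 1‖ₑ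
  else (∑' j : ℕ, ‖f (j + 1) - 1‖ₑ ^ p.toReal / ((j + 1 : ℕ) : ℝ≥0∞)) ^ (1 / p.toReal)

end MeanValue

end

/-! Write `q n` for the positive numbers $p_n$ and set $a_n = M_n/p_n$. Differentiating the
exponentials gives $n p_n = \sum_{j<n} d_{n-j}p_j$ and the same recurrence for $M_n$ with
multipliers $d_j\hat f(j)$. Hence $a_n = \sum_{j<n} w_{n,j}a_j + s_n$, where $w_{n,j} =
d_{n-j}p_j/(np_n)$ are probability weights and $s_n = \sum_j w_{n,j}(\hat f(n-j)-1)a_j$. The weights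
are at most a constant times $n^{-1}(n/(j+1))^{1-d}$, so Hölder with $p>1/d$ makes $s_n$ a relative
error of size $O(\rho)$ (`sum_weight_mul_perturbation_le`).

The core is `exists_oscillation_bound`: a sequence that averages its past up to such errors
satisfies $|a_j-a_i| \le B\rho\,|a_i|\,((i+1)/(j+1))^\varepsilon$ for $j\le i$. The induction has to
absorb the errors $s_n$, so each step must gain a fixed factor below $1$. When $n/(i+1)$ is large,
the gain comes from averaging the ratio power, since a fixed proportion of $w_{n,\cdot}$ lies below
$n/2$ (`OscillationBelow.norm_sub_le_of_far`). When $n/(i+1)$ is bounded, $w_{n,\cdot}$ and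
$w_{i,\cdot}$ share a fixed amount of mass, which cancels in $a_n-a_i$
(`OscillationBelow.norm_sub_le_of_near`).

The oscillation bound also gives polynomial growth of $M_n$. The generating functions therefore
converge in the disc, and $\sum M_jx^j = m(x)\sum p_jx^j$. Thus $m(x)$ is the average of the $a_j$
with weights proportional to $p_jx^j$. At $x=e^{-1/n}$ these weights concentrate around $j\approx n$
(`exists_abel_concentration`), so $m(e^{-1/n}) = a_n(1+O(\rho))$. -/

namespace MeanValue

/-! ### Coefficients of exponentials: recurrence and generating function -/

theorem expCoeff_zero (a : ℕ → ℂ) : expCoeff a 0 = 1 := by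
  unfold expCoeff
  set G : PowerSeries ℂ := PowerSeries.mk fun j : ℕ => if j = 0 then (0 : ℂ) else a j / (j : ℂ)
  have hG : PowerSeries.constantCoeff G = 0 := by
    rw [← PowerSeries.coeff_zero_eq_constantCoeff_apply]; simp [G]
  have hs : PowerSeries.HasSubst G := PowerSeries.HasSubst.of_constantCoeff_zero' hG
  rw [PowerSeries.coeff_subst' hs, finsum_eq_single _ 0]
  · simp
  · intro n hn
    simp [PowerSeries.coeff_zero_eq_constantCoeff_apply, map_pow, hG, hn]

/-- Compare coefficients in $(e^G)' = e^G G'$; the division by $j$ in $G$ disappears on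
differentiation. -/
theorem succ_mul_expCoeff_succ (a : ℕ → ℂ) (n : ℕ) :
    ((n : ℂ) + 1) * expCoeff a (n + 1) =
      ∑ x ∈ Finset.HasAntidiagonal.antidiagonal n, expCoeff a x.1 * a (x.2 + 1) := by
  unfold expCoeff
  set G : PowerSeries ℂ := PowerSeries.mk fun j : ℕ => if j = 0 then (0 : ℂ) else a j / (j : ℂ)
  have hG : PowerSeries.constantCoeff G = 0 := by
    rw [← PowerSeries.coeff_zero_eq_constantCoeff_apply]; simp [G]
  have hs : PowerSeries.HasSubst G := PowerSeries.HasSubst.of_constantCoeff_zero' hG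
  have h := congrArg (PowerSeries.coeff n)
    (PowerSeries.derivative_subst (f := PowerSeries.exp ℂ) hs)
  rw [PowerSeries.derivative_exp, PowerSeries.coeff_derivative, PowerSeries.coeff_mul] at h
  rw [mul_comm, h]
  refine Finset.sum_congr rfl fun x _ => ?_
  rw [PowerSeries.coeff_derivative]
  congr 1
  have : ((x.2 : ℂ) + 1) ≠ 0 := by exact_mod_cast Nat.succ_ne_zero x.2
  simp only [G, PowerSeries.coeff_mk, Nat.succ_ne_zero, if_false]
  push_cast
  field_simp

theorem mul_expCoeff (a : ℕ → ℂ) (n : ℕ) :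
    (n : ℂ) * expCoeff a n = ∑ j ∈ Finset.range n, a (n - j) * expCoeff a j := by
  cases n with
  | zero => simp
  | succ n =>
    push_cast
    rw [succ_mul_expCoeff_succ, Finset.Nat.sum_antidiagonal_eq_sum_range_succ_mk]
    refine Finset.sum_congr rfl fun j hj => ?_
    have : n - j + 1 = n + 1 - j := by
      have := Finset.mem_range.1 hj
      omega
    rw [this, mul_comm]

theorem summable_polynomial_mul_pow (k : ℕ) {r : ℝ} (h0 : 0 ≤ r) (h1 : r < 1) :
    Summable fun n : ℕ => ((n : ℝ) + 1) ^ k * r ^ n := by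
  rcases h0.eq_or_lt with rfl | hpos
  · refine summable_of_ne_finset_zero (s := {0}) fun n hn => ?_
    have : n ≠ 0 := by simpa using hn
    simp [this]
  have h := (summable_pow_mul_geometric_of_norm_lt_one (R := ℝ) k (r := r)
    (by rwa [Real.norm_of_nonneg h0]))
  have h2 := ((summable_nat_add_iff 1).2 h).mul_right r⁻¹
  refine h2.congr fun n => ?_
  push_cast
  rw [pow_succ]
  field_simp

theorem summable_norm_coeff_mul_pow {c : ℕ → ℂ} {C : ℝ} {k : ℕ}
    (hc : ∀ n, ‖c n‖ ≤ C * ((n : ℝ) + 1) ^ k) {z : ℂ} (hz : ‖z‖ < 1) :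
    Summable fun n => ‖c n * z ^ n‖ := by
  refine Summable.of_nonneg_of_le (fun n => norm_nonneg _) (fun n => ?_)
    ((summable_polynomial_mul_pow k (norm_nonneg z) hz).mul_left C)
  rw [norm_mul, norm_pow, ← mul_assoc]
  gcongr
  exact hc n

theorem hasDerivAt_tsum_coeff_mul_pow {c : ℕ → ℂ} {C : ℝ} {k : ℕ}
    (hc : ∀ n, ‖c n‖ ≤ C * ((n : ℝ) + 1) ^ k) {z : ℂ} (hz : ‖z‖ < 1) :
    HasDerivAt (fun w : ℂ => ∑' n, c n * w ^ n)
      (∑' n : ℕ, (((n : ℂ) + 1) * c (n + 1)) * z ^ n) z := by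
  obtain ⟨R, hzR, hR1⟩ := exists_between hz
  have hR0 : 0 ≤ R := (norm_nonneg z).trans hzR.le
  have hC : 0 ≤ C := by simpa using (norm_nonneg _).trans (hc 0)
  set u : ℕ → ℝ := fun n => C * ((n : ℝ) + 1) ^ k * (n * R ^ (n - 1))
  have hu : Summable u := by
    rw [← summable_nat_add_iff 1]
    have h := ((summable_polynomial_mul_pow (k + 1) hR0 hR1).mul_left (C * 2 ^ k))
    refine Summable.of_nonneg_of_le (fun n => by positivity) (fun n => ?_) h
    simp only [u, Nat.add_sub_cancel]
    push_cast
    have : ((n : ℝ) + 1 + 1) ^ k ≤ 2 ^ k * ((n : ℝ) + 1) ^ k := by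
      rw [← mul_pow]
      gcongr
      linarith [(Nat.cast_nonneg n : (0 : ℝ) ≤ n)]
    calc C * ((n : ℝ) + 1 + 1) ^ k * ((n + 1) * R ^ n)
        ≤ C * (2 ^ k * ((n : ℝ) + 1) ^ k) * ((n + 1) * R ^ n) := by gcongr
      _ = _ := by ring
  have key : ∀ (n : ℕ) (y : ℂ), y ∈ Metric.ball (0 : ℂ) R →
      ‖c n * (n * y ^ (n - 1))‖ ≤ u n := by
    intro n y hy
    have hy' : ‖y‖ ≤ R := by simpa using (Metric.mem_ball.1 hy).le
    rw [norm_mul, norm_mul, norm_pow, Complex.norm_natCast]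
    simp only [u]
    gcongr
    exact hc n
  have h := hasDerivAt_tsum_of_isPreconnected (u := u) (t := Metric.ball (0 : ℂ) R)
    (g := fun n w => c n * w ^ n) (g' := fun n w => c n * (n * w ^ (n - 1))) (y₀ := 0) (y := z)
    hu Metric.isOpen_ball (convex_ball _ _).isPreconnected
    (fun n y _ => (hasDerivAt_pow n y).const_mul (c n)) key
    (by simpa using (norm_nonneg z).trans_lt hzR)
    (summable_of_ne_finset_zero (s := {0}) fun n hn => by
      have : n ≠ 0 := by simpa using hn
      simp [this])
    (by simpa using hzR)
  convert! h using 1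
  have hs : Summable fun n : ℕ => c n * (n * z ^ (n - 1)) :=
    Summable.of_norm_bounded hu fun n => key n z (by simpa using hzR)
  rw [hs.tsum_eq_zero_add]
  simp only [Nat.cast_zero, zero_mul, mul_zero, zero_add, Nat.add_sub_cancel]
  refine tsum_congr fun n => ?_
  push_cast
  ring

/-- Passes from the formal identity to the analytic one. With $F$ the sum of the coefficients'
series and $G$ the exponent, the recurrence says $F'=FG'$ in the disc, so $Fe^{-G}$ is constant
there, with value $1$ at the origin. The polynomial bound `hE` is an input here; for $M_n$ it comes
later from the oscillation estimate. -/
theorem tsum_expCoeff_mul_pow {a : ℕ → ℂ} {C : ℝ} {k : ℕ}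
    (ha : ∀ n, 1 ≤ n → ‖a n‖ ≤ C * ((n : ℝ) + 1) ^ k)
    (hE : ∀ n, ‖expCoeff a n‖ ≤ C * ((n : ℝ) + 1) ^ k) {z : ℂ} (hz : ‖z‖ < 1) :
    ∑' n, expCoeff a n * z ^ n =
      Complex.exp (∑' j : ℕ, a (j + 1) / ((j + 1 : ℕ) : ℂ) * z ^ (j + 1)) := by
  have hC : 0 ≤ C := by simpa using (norm_nonneg _).trans (hE 0)
  set g : ℕ → ℂ := fun j => if j = 0 then 0 else a j / (j : ℂ) with hg
  have hgb : ∀ n, ‖g n‖ ≤ C * ((n : ℝ) + 1) ^ k := by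
    intro n
    rcases Nat.eq_zero_or_pos n with rfl | hn
    · simp [g, hC]
    · simp only [g, hn.ne', if_false, norm_div, Complex.norm_natCast]
      exact (div_le_self (norm_nonneg _) (by exact_mod_cast hn)).trans (ha n hn)
  have hgs : ∀ w : ℂ, ‖w‖ < 1 → ∑' j : ℕ, a (j + 1) / ((j + 1 : ℕ) : ℂ) * w ^ (j + 1) =
      ∑' j, g j * w ^ j := by
    intro w hw
    rw [(summable_norm_coeff_mul_pow hgb hw).of_norm.tsum_eq_zero_add]
    simp [g]
  rw [hgs z hz]
  set F : ℂ → ℂ := fun w => ∑' n, expCoeff a n * w ^ n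
  set G : ℂ → ℂ := fun w => ∑' n, g n * w ^ n
  have hF : ∀ w : ℂ, ‖w‖ < 1 → HasDerivAt F
      (∑' n : ℕ, (((n : ℂ) + 1) * expCoeff a (n + 1)) * w ^ n) w := fun w hw =>
    hasDerivAt_tsum_coeff_mul_pow hE hw
  have hG : ∀ w : ℂ, ‖w‖ < 1 → HasDerivAt G
      (∑' n : ℕ, (((n : ℂ) + 1) * g (n + 1)) * w ^ n) w := fun w hw =>
    hasDerivAt_tsum_coeff_mul_pow hgb hw
  have hg1 : ∀ n : ℕ, ((n : ℂ) + 1) * g (n + 1) = a (n + 1) := by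
    intro n
    have : ((n : ℂ) + 1) ≠ 0 := by exact_mod_cast Nat.succ_ne_zero n
    simp only [g, Nat.succ_ne_zero, if_false]
    push_cast
    field_simp
  have hprod : ∀ w : ℂ, ‖w‖ < 1 →
      (∑' n : ℕ, (((n : ℂ) + 1) * expCoeff a (n + 1)) * w ^ n) =
        F w * ∑' n : ℕ, (((n : ℂ) + 1) * g (n + 1)) * w ^ n := by
    intro w hw
    simp only [hg1]
    have ha' : ∀ n : ℕ, ‖a (n + 1)‖ ≤ C * 2 ^ k * ((n : ℝ) + 1) ^ k := by
      intro n
      refine (ha (n + 1) (by omega)).trans ?_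
      rw [mul_assoc, ← mul_pow]
      push_cast
      gcongr
      linarith [(Nat.cast_nonneg n : (0 : ℝ) ≤ n)]
    rw [tsum_mul_tsum_eq_tsum_sum_antidiagonal_of_summable_norm
      (summable_norm_coeff_mul_pow hE hw) (summable_norm_coeff_mul_pow ha' hw)]
    refine tsum_congr fun n => ?_
    rw [succ_mul_expCoeff_succ, Finset.sum_mul]
    refine Finset.sum_congr rfl fun x hx => ?_
    rw [← Finset.HasAntidiagonal.mem_antidiagonal.1 hx, pow_add]
    ring
  have hH : ∀ w ∈ Metric.ball (0 : ℂ) 1,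
      HasDerivAt (fun w => F w * Complex.exp (-G w)) 0 w := by
    intro w hw
    have hw' : ‖w‖ < 1 := by simpa using hw
    have h := (hF w hw').mul ((hG w hw').neg.cexp)
    convert! h using 1
    rw [hprod w hw']
    ring
  have hconst := Metric.isOpen_ball.is_const_of_fderiv_eq_zero
    (convex_ball (0 : ℂ) 1).isPreconnected
    (fun w hw => (hH w hw).differentiableAt.differentiableWithinAt)
    (fun w hw => by
      ext
      simp [(hH w hw).hasFDerivAt.fderiv])
    (x := z) (y := 0) (by simpa using hz) (by simp)
  have h0 : F 0 * Complex.exp (-G 0) = 1 := by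
    have h1 : F 0 = 1 := by
      simp only [F]
      rw [tsum_eq_single 0 (fun n hn => by simp [hn])]
      simp [expCoeff_zero]
    have h2 : G 0 = 0 := by
      simp only [G]
      rw [tsum_eq_single 0 (fun n hn => by simp [hn])]
      simp [g]
    simp [h1, h2]
  simp only [h0] at hconst
  change F z = Complex.exp (G z)
  rw [Complex.exp_neg] at hconst
  exact (mul_inv_eq_one₀ (Complex.exp_ne_zero _)).1 hconst

/-! ### Positive recurrences: partial sums, weights and their moments -/

/-- The recurrence `n q_n = ∑_{j < n} D_{n-j} q_j` with multipliers between `d` and `A`. -/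
structure PositiveRecurrence (d A : ℝ) (D q : ℕ → ℝ) : Prop where
  d_pos : 0 < d
  d_le_one : d ≤ 1
  one_le_A : 1 ≤ A
  lower : ∀ j, 1 ≤ j → d ≤ D j
  upper : ∀ j, 1 ≤ j → D j ≤ A
  zero : q 0 = 1
  mul_eq : ∀ n : ℕ, (n : ℝ) * q n = ∑ j ∈ Finset.range n, D (n - j) * q j

/-- The sum of the first `n` terms of `q`. -/
noncomputable def partialSum (q : ℕ → ℝ) (n : ℕ) : ℝ := ∑ j ∈ Finset.range n, q j

/-- The probability weights for which `q`-normalised sequences are averages of their past;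
the index `0` carries the unit mass at `0`. -/
noncomputable def weight (D q : ℕ → ℝ) (n j : ℕ) : ℝ :=
  if n = 0 then (if j = 0 then 1 else 0)
  else if j < n then D (n - j) * q j / (n * q n) else 0

/-- A discrete form of $\int_0^n t^{-\theta}\,dt$. The induction step is Bernoulli's inequality for
$(1-1/(m+1))^{1-\theta}$. -/
theorem sum_rpow_div_le (n : ℕ) {θ : ℝ} (h0 : 0 ≤ θ) (h1 : θ < 1) :
    ∑ j ∈ Finset.range n, ((n : ℝ) / ((j : ℝ) + 1)) ^ θ ≤ n / (1 - θ) := by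
  have h1' : 0 < 1 - θ := by linarith
  have key : ∀ m : ℕ, ∑ j ∈ Finset.range m, ((j : ℝ) + 1) ^ (-θ) ≤ (m : ℝ) ^ (1 - θ) / (1 - θ) := by
    intro m
    induction m with
    | zero => simp [Real.zero_rpow h1'.ne']
    | succ m ih =>
      rw [Finset.sum_range_succ]
      have hm : (0 : ℝ) < (m : ℝ) + 1 := by positivity
      have hb := rpow_one_add_le_one_add_mul_self (s := -1 / ((m : ℝ) + 1)) (p := 1 - θ)
        (by rw [neg_div, neg_le_neg_iff, div_le_one hm]; linarith [(Nat.cast_nonneg m : (0 : ℝ) ≤ m)])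
        h1'.le (by linarith)
      have e : 1 + -1 / ((m : ℝ) + 1) = m / (m + 1) := by field_simp; ring
      rw [e, Real.div_rpow (by positivity) hm.le, div_le_iff₀ (by positivity)] at hb
      have e2 : ((m : ℝ) + 1) ^ (-θ) = ((m : ℝ) + 1) ^ (1 - θ) / (m + 1) := by
        rw [Real.rpow_sub hm, Real.rpow_neg hm.le, Real.rpow_one]
        field_simp
      rw [e2]
      push_cast
      calc ∑ j ∈ Finset.range m, ((j : ℝ) + 1) ^ (-θ) + ((m : ℝ) + 1) ^ (1 - θ) / (m + 1)
          ≤ (m : ℝ) ^ (1 - θ) / (1 - θ) + ((m : ℝ) + 1) ^ (1 - θ) / (m + 1) := by gcongr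
        _ ≤ ((1 + (1 - θ) * (-1 / ((m : ℝ) + 1))) * ((m : ℝ) + 1) ^ (1 - θ)) / (1 - θ)
            + ((m : ℝ) + 1) ^ (1 - θ) / (m + 1) := by gcongr
        _ = ((m : ℝ) + 1) ^ (1 - θ) / (1 - θ) := by field_simp; ring
  rcases Nat.eq_zero_or_pos n with rfl | hn
  · simp
  have hn' : (0 : ℝ) < n := by exact_mod_cast hn
  calc ∑ j ∈ Finset.range n, ((n : ℝ) / ((j : ℝ) + 1)) ^ θ
      = (n : ℝ) ^ θ * ∑ j ∈ Finset.range n, ((j : ℝ) + 1) ^ (-θ) := by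
        rw [Finset.mul_sum]
        refine Finset.sum_congr rfl fun j _ => ?_
        rw [Real.div_rpow hn'.le (by positivity), Real.rpow_neg (by positivity), div_eq_mul_inv]
    _ ≤ (n : ℝ) ^ θ * ((n : ℝ) ^ (1 - θ) / (1 - θ)) := by gcongr; exact key n
    _ = n / (1 - θ) := by
        rw [← mul_div_assoc, ← Real.rpow_add hn']
        simp

theorem partialSum_succ (q : ℕ → ℝ) (n : ℕ) :
    partialSum q (n + 1) = partialSum q n + q n := Finset.sum_range_succ _ _

namespace PositiveRecurrence

variable {d A : ℝ} {D q : ℕ → ℝ}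

theorem A_pos (h : PositiveRecurrence d A D q) : 0 < A := one_pos.trans_le h.one_le_A

theorem pos (h : PositiveRecurrence d A D q) (n : ℕ) : 0 < q n := by
  induction n using Nat.strong_induction_on with
  | _ n ih =>
    rcases Nat.eq_zero_or_pos n with rfl | hn
    · rw [h.zero]; exact one_pos
    have hs : 0 < ∑ j ∈ Finset.range n, D (n - j) * q j := by
      refine Finset.sum_pos (fun j hj => ?_) ⟨0, Finset.mem_range.2 hn⟩
      have hj' := Finset.mem_range.1 hj
      exact mul_pos (h.d_pos.trans_le (h.lower _ (by omega))) (ih j hj')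
    rw [← h.mul_eq] at hs
    exact (pos_iff_pos_of_mul_pos hs).1 (by exact_mod_cast hn)

theorem one_le_partialSum (h : PositiveRecurrence d A D q) {n : ℕ} (hn : 1 ≤ n) :
    1 ≤ partialSum q n := by
  rw [← h.zero]
  exact Finset.single_le_sum (f := q) (fun j _ => (h.pos j).le) (Finset.mem_range.2 hn)

theorem partialSum_pos (h : PositiveRecurrence d A D q) {n : ℕ} (hn : 1 ≤ n) :
    0 < partialSum q n := one_pos.trans_le (h.one_le_partialSum hn)

theorem partialSum_mono (h : PositiveRecurrence d A D q) : Monotone (partialSum q) :=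
  monotone_nat_of_le_succ fun n => by rw [partialSum_succ]; linarith [h.pos n]

theorem mul_partialSum_le (h : PositiveRecurrence d A D q) (n : ℕ) :
    d * partialSum q n ≤ n * q n := by
  rw [h.mul_eq, partialSum, Finset.mul_sum]
  refine Finset.sum_le_sum fun j hj => ?_
  have := Finset.mem_range.1 hj
  exact mul_le_mul_of_nonneg_right (h.lower _ (by omega)) (h.pos j).le

theorem mul_le_partialSum (h : PositiveRecurrence d A D q) (n : ℕ) :
    n * q n ≤ A * partialSum q n := by
  rw [h.mul_eq, partialSum, Finset.mul_sum]
  refine Finset.sum_le_sum fun j hj => ?_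
  have := Finset.mem_range.1 hj
  exact mul_le_mul_of_nonneg_right (h.upper _ (by omega)) (h.pos j).le

/-- The recurrence gives $Q_{n+1}\ge Q_n(1+d/n)$, and $1+d/n\ge(1+1/n)^d$ by Bernoulli because
$d\le1$. The matching upper bound uses $A\ge1$ in the same way; this is the reason for the
normalisation of the two constants. -/
theorem partialSum_mul_rpow_le (h : PositiveRecurrence d A D q) {m n : ℕ} (hm : 1 ≤ m)
    (hmn : m ≤ n) : partialSum q m * ((n : ℝ) / m) ^ d ≤ partialSum q n := by
  have hm' : (0 : ℝ) < m := by exact_mod_cast hm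
  induction n, hmn using Nat.le_induction with
  | base => simp [hm'.ne']
  | succ n hn ih =>
    have hn' : (0 : ℝ) < n := by exact_mod_cast hm.trans hn
    have hb := rpow_one_add_le_one_add_mul_self (s := 1 / (n : ℝ)) (p := d)
      (by have : 0 < 1 / (n : ℝ) := by positivity
          linarith) h.d_pos.le h.d_le_one
    have e : ((n + 1 : ℕ) : ℝ) / m = (n / m) * (1 + 1 / n) := by push_cast; field_simp
    rw [e, Real.mul_rpow (by positivity) (by positivity), partialSum_succ, ← mul_assoc]
    have h1 := h.mul_partialSum_le n
    calc partialSum q m * ((n : ℝ) / m) ^ d * (1 + 1 / (n : ℝ)) ^ d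
        ≤ partialSum q n * (1 + d * (1 / n)) :=
          mul_le_mul ih hb (by positivity) (h.partialSum_pos (hm.trans hn)).le
      _ = partialSum q n + (d * partialSum q n) / n := by field_simp
      _ ≤ partialSum q n + (n * q n) / n := by gcongr
      _ = _ := by field_simp

theorem partialSum_le_mul_rpow (h : PositiveRecurrence d A D q) {m n : ℕ} (hm : 1 ≤ m)
    (hmn : m ≤ n) : partialSum q n ≤ partialSum q m * ((n : ℝ) / m) ^ A := by
  have hm' : (0 : ℝ) < m := by exact_mod_cast hm
  induction n, hmn using Nat.le_induction with
  | base => simp [hm'.ne']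
  | succ n hn ih =>
    have hn' : (0 : ℝ) < n := by exact_mod_cast hm.trans hn
    have hb := one_add_mul_self_le_rpow_one_add (s := 1 / (n : ℝ)) (p := A)
      (by have : 0 < 1 / (n : ℝ) := by positivity
          linarith) h.one_le_A
    have e : ((n + 1 : ℕ) : ℝ) / m = (n / m) * (1 + 1 / n) := by push_cast; field_simp
    rw [e, Real.mul_rpow (by positivity) (by positivity), partialSum_succ, ← mul_assoc]
    have h1 := h.mul_le_partialSum n
    have hA := h.A_pos
    have hQ := h.partialSum_pos hm
    calc partialSum q n + q n = partialSum q n + (n * q n) / n := by field_simp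
      _ ≤ partialSum q n + (A * partialSum q n) / n := by gcongr
      _ = partialSum q n * (1 + A * (1 / n)) := by field_simp
      _ ≤ partialSum q m * ((n : ℝ) / m) ^ A * (1 + 1 / (n : ℝ)) ^ A :=
          mul_le_mul ih hb (by positivity) (by positivity)

/-- Shifting both the denominator and the partial sum by one makes the bound meaningful at $j=0$ as
well. -/
theorem le_partialSum_div (h : PositiveRecurrence d A D q) (j : ℕ) :
    q j ≤ 2 * A * partialSum q (j + 1) / ((j : ℝ) + 1) := by
  have hj : (0 : ℝ) < (j : ℝ) + 1 := by positivity
  have hA := h.one_le_A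
  have hq := h.pos j
  have hQ : 0 ≤ partialSum q j := Finset.sum_nonneg fun i _ => (h.pos i).le
  have h1 := h.mul_le_partialSum j
  rw [le_div_iff₀ hj, partialSum_succ]
  nlinarith [mul_le_mul_of_nonneg_right hA hq.le, mul_nonneg h.A_pos.le hQ]

theorem weight_of_lt {n j : ℕ} (hj : j < n) :
    weight D q n j = D (n - j) * q j / (n * q n) := by
  simp [weight, hj, Nat.ne_zero_of_lt hj]

theorem weight_nonneg (h : PositiveRecurrence d A D q) (n j : ℕ) : 0 ≤ weight D q n j := by
  unfold weight
  split_ifs with h1 h2 h3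
  · exact zero_le_one
  · exact le_rfl
  · have hD : 0 ≤ D (n - j) := h.d_pos.le.trans (h.lower _ (by omega))
    have := h.pos j
    have := h.pos n
    positivity
  · exact le_rfl

theorem weight_eq_zero {n N j : ℕ} (hn : n ≤ N) (hN : 1 ≤ N) (hj : N ≤ j) :
    weight D q n j = 0 := by
  unfold weight
  split_ifs <;> first | rfl | omega

theorem sum_weight_mul {E : Type*} [AddCommMonoid E] [Module ℝ E] {n : ℕ} (hn : 1 ≤ n) {N : ℕ}
    (hN : n ≤ N) (φ : ℕ → E) :
    ∑ j ∈ Finset.range N, weight D q n j • φ j = ∑ j ∈ Finset.range n, weight D q n j • φ j := by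
  symm
  refine Finset.sum_subset (Finset.range_mono hN) fun j _ hj => ?_
  rw [weight_eq_zero le_rfl hn (by simpa using hj), zero_smul]

theorem sum_weight (h : PositiveRecurrence d A D q) {n N : ℕ} (hn : n ≤ N) (hN : 1 ≤ N) :
    ∑ j ∈ Finset.range N, weight D q n j = 1 := by
  rcases Nat.eq_zero_or_pos n with rfl | hn0
  · simp [weight, Finset.sum_ite_eq']
    omega
  have := sum_weight_mul (D := D) (q := q) hn0 hn (fun _ => (1 : ℝ))
  simp only [smul_eq_mul, mul_one] at this
  rw [this]
  have hq := h.pos n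
  have hn' : (0 : ℝ) < n := by exact_mod_cast hn0
  rw [Finset.sum_congr rfl fun j hj => weight_of_lt (D := D) (q := q) (Finset.mem_range.1 hj),
    ← Finset.sum_div, ← h.mul_eq, div_self (by positivity)]

/-- Combine $nq_n\ge dQ_n$, $q_j\le 2AQ_{j+1}/(j+1)$ and the power growth of $Q$ between $j+1$ and
$n$. The exponent $1-d<1$ makes the weights summable uniformly in $n$, with room for a further small
power. -/
theorem weight_le (h : PositiveRecurrence d A D q) {n j : ℕ} (hj : j < n) :
    weight D q n j ≤ 2 * A ^ 2 / d * ((1 / (n : ℝ)) * ((n : ℝ) / ((j : ℝ) + 1)) ^ (1 - d)) := by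
  have hn : 1 ≤ n := by omega
  have hn' : (0 : ℝ) < n := by exact_mod_cast hn
  have hj' : (0 : ℝ) < (j : ℝ) + 1 := by positivity
  have hd := h.d_pos
  have hA := h.A_pos
  have hQ := h.partialSum_pos hn
  have h1 := h.mul_partialSum_le n
  have h2 := h.le_partialSum_div j
  have h3 := h.partialSum_mul_rpow_le (m := j + 1) (n := n) (by omega) (by omega)
  have h4 := h.upper (n - j) (by omega)
  push_cast at h3
  have hy : 0 < (n : ℝ) / ((j : ℝ) + 1) := by positivity
  have h3' : partialSum q (j + 1) ≤ partialSum q n / ((n : ℝ) / ((j : ℝ) + 1)) ^ d :=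
    (le_div_iff₀ (by positivity)).2 h3
  rw [weight_of_lt hj]
  calc D (n - j) * q j / (n * q n)
      ≤ A * (2 * A * (partialSum q n / ((n : ℝ) / ((j : ℝ) + 1)) ^ d) / ((j : ℝ) + 1))
          / (d * partialSum q n) := by
        have := h.pos j
        gcongr
        exact h2.trans (by gcongr)
    _ = 2 * A ^ 2 / d * ((1 / (n : ℝ)) * ((n : ℝ) / ((j : ℝ) + 1)) ^ (1 - d)) := by
        rw [Real.rpow_sub hy, Real.rpow_one]
        field_simp

theorem le_weight (h : PositiveRecurrence d A D q) {n j : ℕ} (hj : j < n) :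
    d / A * (q j / partialSum q n) ≤ weight D q n j := by
  have hn : 1 ≤ n := by omega
  have hd := h.d_pos
  have hA := h.A_pos
  have hQ := h.partialSum_pos hn
  have h1 := h.mul_le_partialSum n
  have hq := h.pos j
  have hqn := h.pos n
  have hn' : (0 : ℝ) < n := by exact_mod_cast hn
  have h4 := h.lower (n - j) (by omega)
  rw [weight_of_lt hj]
  calc d / A * (q j / partialSum q n) = d * q j / (A * partialSum q n) := by field_simp
    _ ≤ D (n - j) * q j / (n * q n) := by
      have : 0 ≤ D (n - j) := hd.le.trans h4
      gcongr

theorem sum_weight_rpow_le (h : PositiveRecurrence d A D q) (n : ℕ) :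
    ∑ j ∈ Finset.range n, weight D q n j * ((n : ℝ) / ((j : ℝ) + 1)) ^ (d / 2) ≤
      4 * A ^ 2 / d ^ 2 := by
  have hd := h.d_pos
  have hd1 := h.d_le_one
  have hA := h.A_pos
  rcases Nat.eq_zero_or_pos n with rfl | hn
  · simp; positivity
  have hn' : (0 : ℝ) < n := by exact_mod_cast hn
  calc ∑ j ∈ Finset.range n, weight D q n j * ((n : ℝ) / ((j : ℝ) + 1)) ^ (d / 2)
      ≤ ∑ j ∈ Finset.range n, 2 * A ^ 2 / d * (1 / n) *
          ((n : ℝ) / ((j : ℝ) + 1)) ^ (1 - d / 2) := by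
        refine Finset.sum_le_sum fun j hj => ?_
        have hy : 0 < (n : ℝ) / ((j : ℝ) + 1) := by positivity
        have e : (1 - d / 2) = (1 - d) + d / 2 := by ring
        rw [e, Real.rpow_add hy, ← mul_assoc]
        gcongr
        simpa only [mul_assoc] using h.weight_le (Finset.mem_range.1 hj)
    _ ≤ 2 * A ^ 2 / d * (1 / n) * (n / (1 - (1 - d / 2))) := by
        rw [← Finset.mul_sum]
        gcongr
        exact sum_rpow_div_le n (by linarith) (by linarith)
    _ = 4 * A ^ 2 / d ^ 2 := by
        have e : 1 - (1 - d / 2) = d / 2 := by ring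
        rw [e]
        field_simp
        norm_num

/-- A fixed proportion of the mass sits at $j<n/2$: it is at least $(d/A)\,Q_{\lfloor
n/2\rfloor}/Q_n\ge (d/A)3^{-A}$, and there $(j+1)/n\le 1/2$. This deficit is the source of the gain
in the far case. -/
theorem sum_weight_mul_div_le (h : PositiveRecurrence d A D q) {n : ℕ} (hn : 2 ≤ n) :
    ∑ j ∈ Finset.range n, weight D q n j * (((j : ℝ) + 1) / n) ≤
      1 - d / A * (1 / 2) * (1 / 3) ^ A := by
  have hd := h.d_pos
  have hA := h.A_pos
  have hn' : (0 : ℝ) < n := by positivity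
  have hQ := h.partialSum_pos (n := n) (by omega)
  set m := n / 2
  have hm : 1 ≤ m := by omega
  have hm' : (0 : ℝ) < m := by exact_mod_cast hm
  have hQm := h.partialSum_le_mul_rpow (n := n) hm (by omega)
  have hratio : ((n : ℝ) / m) ≤ 3 := by
    rw [div_le_iff₀ hm']
    exact_mod_cast (by omega : n ≤ 3 * m)
  have hr : (1 / 3 : ℝ) ^ A ≤ partialSum q m / partialSum q n := by
    rw [le_div_iff₀ hQ, Real.div_rpow (by norm_num) (by norm_num), Real.one_rpow]
    have : partialSum q n ≤ partialSum q m * 3 ^ A :=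
      hQm.trans (by have := h.partialSum_pos hm; gcongr)
    rw [div_mul_eq_mul_div, one_mul, div_le_iff₀ (by positivity)]
    exact this
  have hmain : d / A * (1 / 2) * (1 / 3) ^ A ≤
      ∑ j ∈ Finset.range n, weight D q n j * (1 - ((j : ℝ) + 1) / n) := by
    calc d / A * (1 / 2) * (1 / 3) ^ A
        ≤ d / A * (1 / 2) * (partialSum q m / partialSum q n) := by gcongr
      _ = ∑ j ∈ Finset.range m, d / A * (q j / partialSum q n) * (1 / 2) := by
          simp only [partialSum, Finset.sum_div, Finset.mul_sum]
          exact Finset.sum_congr rfl fun j _ => by ring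
      _ ≤ ∑ j ∈ Finset.range m, weight D q n j * (1 - ((j : ℝ) + 1) / n) := by
          refine Finset.sum_le_sum fun j hj => ?_
          have hj' := Finset.mem_range.1 hj
          have h5 : ((j : ℝ) + 1) / n ≤ 1 / 2 := by
            rw [div_le_div_iff₀ hn' (by norm_num)]
            exact_mod_cast (by omega : (j + 1) * 2 ≤ 1 * n)
          exact mul_le_mul (h.le_weight (by omega)) (by linarith) (by norm_num)
            (h.weight_nonneg _ _)
      _ ≤ _ := by
          refine Finset.sum_le_sum_of_subset_of_nonneg (Finset.range_mono (by omega))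
            fun j hj _ => mul_nonneg (h.weight_nonneg _ _) ?_
          have hj' := Finset.mem_range.1 hj
          rw [sub_nonneg, div_le_one hn']
          exact_mod_cast hj'
  have e := h.sum_weight (le_refl n) (by omega)
  simp only [mul_sub, mul_one, Finset.sum_sub_distrib, e] at hmain
  linarith

/-- Hölder's inequality with `weight_le`: the weight and the allowed growth of `b` give the power
$1-d+\varepsilon$ of $n/(j+1)$, whose $p'$-th power is summable by `hε'`. The factors
$n^{1/p}n^{1/p'}$ cancel the $1/n$ in the weight. -/
theorem sum_weight_mul_perturbation_le (h : PositiveRecurrence d A D q) {p p' : ℝ}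
    (hp : p.HolderConjugate p') {ε : ℝ} (hε : 0 ≤ ε) (hε' : (1 - d + ε) * p' < 1)
    {g : ℕ → ℝ} (hg : ∀ k, 0 ≤ g k) {ρ : ℝ} (hρ : 0 ≤ ρ)
    (hgρ : ∀ n : ℕ, ∑ k ∈ Finset.range n, g (k + 1) ^ p ≤ n * ρ ^ p)
    {n : ℕ} {b : ℕ → ℝ} {X : ℝ} (hX : 0 ≤ X)
    (hb : ∀ j < n, b j ≤ X * ((n : ℝ) / ((j : ℝ) + 1)) ^ ε) :
    ∑ j ∈ Finset.range n, weight D q n j * (g (n - j) * b j) ≤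
      2 * A ^ 2 / d * (1 / (1 - (1 - d + ε) * p')) ^ (1 / p') * ρ * X := by
  have hd := h.d_pos
  have hd1 := h.d_le_one
  have hA := h.A_pos
  have hp0 := hp.pos
  have hp0' := hp.symm.pos
  have hθ : 0 < 1 - (1 - d + ε) * p' := by linarith
  rcases Nat.eq_zero_or_pos n with rfl | hn
  · simp; positivity
  have hn' : (0 : ℝ) < n := by exact_mod_cast hn
  set y : ℕ → ℝ := fun j => (n : ℝ) / ((j : ℝ) + 1)
  have hy : ∀ j, 0 < y j := fun j => by simp only [y]; positivity
  have h1 : ∑ j ∈ Finset.range n, weight D q n j * (g (n - j) * b j) ≤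
      2 * A ^ 2 / d * (1 / n) * X * ∑ j ∈ Finset.range n, g (n - j) * y j ^ (1 - d + ε) := by
    rw [Finset.mul_sum]
    refine Finset.sum_le_sum fun j hj => ?_
    have hj' := Finset.mem_range.1 hj
    calc weight D q n j * (g (n - j) * b j)
        ≤ (2 * A ^ 2 / d * ((1 / (n : ℝ)) * y j ^ (1 - d))) * (g (n - j) * (X * y j ^ ε)) := by
          have := hy j
          refine (mul_le_mul_of_nonneg_left (mul_le_mul_of_nonneg_left (hb j hj') (hg _))
            (h.weight_nonneg _ _)).trans (mul_le_mul_of_nonneg_right (h.weight_le hj') ?_)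
          exact mul_nonneg (hg _) (by positivity)
      _ = _ := by rw [Real.rpow_add (hy j)]; ring
  have h2 : ∑ j ∈ Finset.range n, g (n - j) * y j ^ (1 - d + ε) ≤
      (n * ρ ^ p) ^ (1 / p) * (n / (1 - (1 - d + ε) * p')) ^ (1 / p') := by
    refine (Real.inner_le_Lp_mul_Lq_of_nonneg _ hp (fun j _ => hg _)
      (fun j _ => by have := hy j; positivity)).trans ?_
    have e1 : ∑ j ∈ Finset.range n, g (n - j) ^ p ≤ n * ρ ^ p := by
      refine le_trans (le_of_eq ?_) (hgρ n)
      rw [← Finset.sum_range_reflect]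
      refine Finset.sum_congr rfl fun j hj => ?_
      have hj' := Finset.mem_range.1 hj
      congr 2
      omega
    have e2 : ∑ j ∈ Finset.range n, (y j ^ (1 - d + ε)) ^ p' ≤ n / (1 - (1 - d + ε) * p') := by
      refine le_trans (le_of_eq ?_) (sum_rpow_div_le n (by nlinarith) hε')
      exact Finset.sum_congr rfl fun j _ => (Real.rpow_mul (hy j).le _ _).symm
    gcongr
    · exact Finset.sum_nonneg fun j _ => Real.rpow_nonneg (hg _) _
  refine h1.trans ((mul_le_mul_of_nonneg_left h2 (by positivity)).trans (le_of_eq ?_))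
  rw [Real.mul_rpow hn'.le (by positivity), ← Real.rpow_mul hρ, mul_one_div_cancel hp0.ne',
    Real.rpow_one, div_eq_mul_one_div (n : ℝ) (1 - _), Real.mul_rpow hn'.le (by positivity)]
  have e : (n : ℝ) ^ (1 / p) * (n : ℝ) ^ (1 / p') = n := by
    rw [← Real.rpow_add hn', one_div, one_div, hp.inv_add_inv_eq_one, Real.rpow_one]
  calc _ = 2 * A ^ 2 / d * (1 / (1 - (1 - d + ε) * p')) ^ (1 / p') * ρ * X * (1 / n) *
        ((n : ℝ) ^ (1 / p) * (n : ℝ) ^ (1 / p')) := by ring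
    _ = _ := by rw [e]; field_simp

end PositiveRecurrence
-- Oscillation of averaging sequences: one step, far and near
-- Since $y^\varepsilon-1\le\varepsilon y^\varepsilon\log y$, the logarithm can be absorbed in a
-- fixed power $y^\beta$. What matters is the factor $\varepsilon$, which makes the loss from small
-- indices controllable.
theorem rpow_sub_one_le {y ε β : ℝ} (hy : 1 ≤ y) (hβ : 0 < β) (hε : 0 ≤ ε) (hεβ : ε ≤ β / 2) :
    y ^ ε - 1 ≤ ε * (2 / β) * y ^ β := by
  have hy0 : 0 < y := by linarith
  have hlog : 0 ≤ Real.log y := Real.log_nonneg hy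
  have h1 : y ^ ε - 1 ≤ ε * Real.log y * y ^ ε := by
    have h := Real.add_one_le_exp (-(Real.log y * ε))
    rw [Real.exp_neg, ← Real.rpow_def_of_pos hy0] at h
    have hp : 0 < y ^ ε := by positivity
    have h2 := mul_le_mul_of_nonneg_right h hp.le
    rw [inv_mul_cancel₀ hp.ne'] at h2
    nlinarith
  have h2 : Real.log y ≤ y ^ (β / 2) / (β / 2) := Real.log_le_rpow_div hy0.le (by positivity)
  have h3 : y ^ ε ≤ y ^ (β / 2) := Real.rpow_le_rpow_of_exponent_le hy hεβ
  have h4 : y ^ β = y ^ (β / 2) * y ^ (β / 2) := by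
    rw [← Real.rpow_add hy0]; congr 1; ring
  calc y ^ ε - 1 ≤ ε * Real.log y * y ^ ε := h1
    _ ≤ ε * (y ^ (β / 2) / (β / 2)) * y ^ (β / 2) := by gcongr
    _ = ε * (2 / β) * y ^ β := by rw [h4]; field_simp

/-- Two averages with weights `x` and `z` of equal mass differ by at most the averaged
oscillation over independent pairs. -/
theorem norm_sum_smul_sub_sum_smul_le {ι E : Type*} [NormedAddCommGroup E] [NormedSpace ℝ E]
    (s : Finset ι) {x z e : ι → ℝ} {a : ι → E} {m T : ℝ} (hm : 0 < m)
    (hx : ∀ j ∈ s, 0 ≤ x j) (hz : ∀ j ∈ s, 0 ≤ z j)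
    (hxm : ∑ j ∈ s, x j = m) (hzm : ∑ j ∈ s, z j = m)
    (ha : ∀ j ∈ s, ∀ k ∈ s, ‖a j - a k‖ ≤ T * (1 + e j + e k)) :
    ‖∑ j ∈ s, x j • a j - ∑ k ∈ s, z k • a k‖ ≤
      T * (m + ∑ j ∈ s, x j * e j + ∑ k ∈ s, z k * e k) := by
  have h1 : m • (∑ j ∈ s, x j • a j - ∑ k ∈ s, z k • a k) =
      ∑ j ∈ s, ∑ k ∈ s, (x j * z k) • (a j - a k) := by
    simp only [smul_sub, Finset.sum_sub_distrib]
    congr 1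
    · simp only [← Finset.sum_smul, ← Finset.mul_sum, hzm, Finset.smul_sum, smul_smul,
        mul_comm m]
    · rw [Finset.sum_comm]
      simp only [← Finset.sum_smul, ← Finset.sum_mul, hxm, Finset.smul_sum, smul_smul]
  have h2 : m * ‖∑ j ∈ s, x j • a j - ∑ k ∈ s, z k • a k‖ ≤
      ∑ j ∈ s, ∑ k ∈ s, (x j * z k) * (T * (1 + e j + e k)) := by
    have hmn := norm_smul m (∑ j ∈ s, x j • a j - ∑ k ∈ s, z k • a k)
    rw [Real.norm_of_nonneg hm.le] at hmn
    rw [← hmn, h1]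
    refine (norm_sum_le _ _).trans (Finset.sum_le_sum fun j hj => (norm_sum_le _ _).trans
      (Finset.sum_le_sum fun k hk => ?_))
    have h0 := mul_nonneg (hx j hj) (hz k hk)
    rw [norm_smul, Real.norm_of_nonneg h0]
    exact mul_le_mul_of_nonneg_left (ha j hj k hk) h0
  have h3 : ∑ j ∈ s, ∑ k ∈ s, (x j * z k) * (T * (1 + e j + e k)) =
      m * (T * (m + ∑ j ∈ s, x j * e j + ∑ k ∈ s, z k * e k)) := by
    have e1 : ∀ j ∈ s, ∑ k ∈ s, (x j * z k) * (T * (1 + e j + e k)) =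
        T * (x j * m + (x j * e j) * m + x j * ∑ k ∈ s, z k * e k) := by
      intro j _
      rw [← hzm, Finset.mul_sum, Finset.mul_sum, Finset.mul_sum, ← Finset.sum_add_distrib,
        ← Finset.sum_add_distrib, Finset.mul_sum]
      exact Finset.sum_congr rfl fun k _ => by ring
    rw [Finset.sum_congr rfl e1, ← Finset.mul_sum, Finset.sum_add_distrib, Finset.sum_add_distrib,
      ← Finset.sum_mul, ← Finset.sum_mul, ← Finset.sum_mul, hxm]
    ring
  rw [h3] at h2
  exact le_of_mul_le_mul_left h2 hm

namespace PositiveRecurrence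

variable {d A : ℝ} {D q : ℕ → ℝ}

/-- With $r=n/(i+1)$ and $u_j=(j+1)/n$, the ratio is $ru_j$ for $j\ge i$, and concavity
$u^\varepsilon\le1+\varepsilon(u-1)$ turns the deficit of the mean of $u$ into a gain of order
$\varepsilon$. The inverted ratios $j<i$ cost $O(\varepsilon r^{-d/2})$, which is smaller than the
gain once $r$ is large, uniformly in $\varepsilon$. -/
theorem sum_weight_mul_ratio_rpow_le (h : PositiveRecurrence d A D q) {n i : ℕ} (hn : 2 ≤ n)
    {ε : ℝ} (hε : 0 ≤ ε) (hεd : ε ≤ d / 8) :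
    ∑ j ∈ Finset.range n, weight D q n j *
        (if i ≤ j then (((j : ℝ) + 1) / ((i : ℝ) + 1)) ^ ε
          else (((i : ℝ) + 1) / ((j : ℝ) + 1)) ^ ε) ≤
      ((n : ℝ) / ((i : ℝ) + 1)) ^ ε * (1 - ε * (d / A * (1 / 2) * (1 / 3) ^ A) +
        2 * ε * (4 / d) * (4 * A ^ 2 / d ^ 2) / ((n : ℝ) / ((i : ℝ) + 1)) ^ (d / 2)) := by
  have hd := h.d_pos
  have hd1 := h.d_le_one
  have hn' : (0 : ℝ) < n := by positivity
  set r : ℝ := (n : ℝ) / ((i : ℝ) + 1) with hr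
  have hr0 : 0 < r := by positivity
  set y : ℕ → ℝ := fun j => (n : ℝ) / ((j : ℝ) + 1) with hy
  set u : ℕ → ℝ := fun j => ((j : ℝ) + 1) / n with hu
  have hu0 : ∀ j, 0 < u j := fun j => by simp only [u]; positivity
  have hy0 : ∀ j, 0 < y j := fun j => by simp only [y]; positivity
  have hu1 : ∀ j < n, u j ≤ 1 := fun j hj => by
    simp only [u]; rw [div_le_one hn']; exact_mod_cast hj
  have hub : ∀ j, u j ^ ε ≤ 1 + ε * (u j - 1) := fun j => by
    have := rpow_one_add_le_one_add_mul_self (s := u j - 1) (p := ε)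
      (by linarith [hu0 j]) hε (by linarith)
    simpa using this
  have key : ∀ j ∈ Finset.range n,
      (if i ≤ j then (((j : ℝ) + 1) / ((i : ℝ) + 1)) ^ ε
          else (((i : ℝ) + 1) / ((j : ℝ) + 1)) ^ ε) ≤
      r ^ ε * (1 + ε * (u j - 1) + 2 * ε * (4 / d) / r ^ (d / 2) * y j ^ (d / 2)) := by
    intro j hj
    have hj' := Finset.mem_range.1 hj
    have hyj := hy0 j
    split_ifs with hij
    · have e : ((j : ℝ) + 1) / ((i : ℝ) + 1) = r * u j := by
        simp only [hr, hu]; field_simp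
      rw [e, Real.mul_rpow hr0.le (hu0 j).le]
      gcongr
      have : 0 ≤ 2 * ε * (4 / d) / r ^ (d / 2) * y j ^ (d / 2) := by positivity
      linarith [hub j]
    · set t : ℝ := ((i : ℝ) + 1) / ((j : ℝ) + 1) with ht
      have ht1 : 1 ≤ t := by
        rw [ht, one_le_div (by positivity)]
        exact_mod_cast (by omega : j + 1 ≤ i + 1)
      have ht0 : 0 < t := by linarith
      -- For $j<i$ the ratio is the reciprocal of $ru_j$. Writing it as $ru_jt^2$ keeps the gain
      -- $u_j^\varepsilon$ and isolates the excess $t^{2\varepsilon}-1$.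
      have e1 : t = r * (u j * (t * t)) := by
        simp only [hr, hu, ht]; field_simp
      have e2 : t ^ ε = r ^ ε * (u j ^ ε * t ^ (2 * ε)) := by
        conv_lhs => rw [e1]
        rw [Real.mul_rpow hr0.le (by have := hu0 j; positivity),
          Real.mul_rpow (hu0 j).le (by positivity), Real.mul_rpow ht0.le ht0.le,
          two_mul, Real.rpow_add ht0]
      have e3 : t ^ (d / 2) = y j ^ (d / 2) / r ^ (d / 2) := by
        rw [← Real.div_rpow hyj.le hr0.le]
        congr 1
        simp only [hr, hy, ht]; field_simp
      have h1 := rpow_sub_one_le ht1 (β := d / 2) (ε := 2 * ε) (by positivity) (by positivity)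
        (by linarith)
      have hu1' : u j ^ ε ≤ 1 := Real.rpow_le_one (hu0 j).le (hu1 j hj') hε
      have h2 : 0 ≤ t ^ (2 * ε) - 1 := by
        linarith [Real.one_le_rpow ht1 (by positivity : 0 ≤ 2 * ε)]
      rw [e2]
      gcongr
      rw [e3] at h1
      have e4 : 2 * ε * (2 / (d / 2)) * (y j ^ (d / 2) / r ^ (d / 2)) =
          2 * ε * (4 / d) / r ^ (d / 2) * y j ^ (d / 2) := by field_simp; ring
      rw [e4] at h1
      nlinarith [hub j, mul_le_mul_of_nonneg_right hu1' h2]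
  have hC := h.sum_weight_rpow_le n
  have hc := h.sum_weight_mul_div_le hn
  have hone := h.sum_weight (le_refl n) (by omega)
  calc _ ≤ ∑ j ∈ Finset.range n, weight D q n j *
        (r ^ ε * (1 + ε * (u j - 1) + 2 * ε * (4 / d) / r ^ (d / 2) * y j ^ (d / 2))) :=
        Finset.sum_le_sum fun j hj => mul_le_mul_of_nonneg_left (key j hj) (h.weight_nonneg _ _)
    _ = r ^ ε * ((1 - ε) * ∑ j ∈ Finset.range n, weight D q n j
          + ε * ∑ j ∈ Finset.range n, weight D q n j * u j
          + 2 * ε * (4 / d) / r ^ (d / 2) *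
            ∑ j ∈ Finset.range n, weight D q n j * y j ^ (d / 2)) := by
        rw [Finset.mul_sum, Finset.mul_sum, Finset.mul_sum, ← Finset.sum_add_distrib,
          ← Finset.sum_add_distrib, Finset.mul_sum]
        exact Finset.sum_congr rfl fun j _ => by ring
    _ ≤ r ^ ε * ((1 - ε) * 1 + ε * (1 - d / A * (1 / 2) * (1 / 3) ^ A)
          + 2 * ε * (4 / d) / r ^ (d / 2) * (4 * A ^ 2 / d ^ 2)) := by
        rw [hone]
        gcongr
    _ = _ := by ring

/-- `a` is an average of its past up to the error `s`, and its oscillation below `n` is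
controlled by `τ`. -/
structure OscillationBelow (D q : ℕ → ℝ) (a s : ℕ → ℂ) (τ ε : ℝ) (n : ℕ) : Prop where
  one_le : 1 ≤ n
  s_zero : s 0 = 0
  average : ∀ m, a m = ∑ j ∈ Finset.range (max m 1), weight D q m j • a j + s m
  norm_sub_le : ∀ i < n, ∀ j ≤ i,
    ‖a j - a i‖ ≤ τ * ‖a i‖ * (((i : ℝ) + 1) / ((j : ℝ) + 1)) ^ ε

theorem average_of_le {a s : ℕ → ℂ}
    (ha : ∀ m, a m = ∑ j ∈ Finset.range (max m 1), weight D q m j • a j + s m) {m N : ℕ}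
    (hm : m ≤ N) (hN : 1 ≤ N) : a m = ∑ j ∈ Finset.range N, weight D q m j • a j + s m := by
  conv_lhs => rw [ha m]
  congr 1
  refine Finset.sum_subset (Finset.range_mono (by omega)) fun j _ hj => ?_
  rw [weight_eq_zero (N := max m 1) (by omega) (by omega) (le_of_not_gt fun h => hj (Finset.mem_range.2 h)),
    zero_smul]

theorem OscillationBelow.norm_le {a s : ℕ → ℂ} {τ ε : ℝ} {n : ℕ}
    (ho : OscillationBelow D q a s τ ε n) {i : ℕ} (hi : i < n) :
    ‖a i‖ ≤ ‖a (n - 1)‖ * (1 + τ * ((n : ℝ) / ((i : ℝ) + 1)) ^ ε) := by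
  have hn := ho.one_le
  have h := ho.norm_sub_le (n - 1) (by omega) i (by omega)
  have e : ((n - 1 : ℕ) : ℝ) + 1 = n := by
    rw [Nat.cast_sub hn]; simp
  rw [e] at h
  have := norm_sub_norm_le (a i) (a (n - 1))
  linarith

theorem OscillationBelow.norm_le_two_mul {a s : ℕ → ℂ} {τ ε : ℝ} {n : ℕ} (hτ : τ ≤ 1)
    (hε : 0 ≤ ε) (ho : OscillationBelow D q a s τ ε n) {i : ℕ} (hi : i < n) :
    ‖a i‖ ≤ 2 * ‖a (n - 1)‖ * ((n : ℝ) / ((i : ℝ) + 1)) ^ ε := by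
  have hr : 1 ≤ (n : ℝ) / ((i : ℝ) + 1) := by
    rw [one_le_div (by positivity)]; exact_mod_cast hi
  have h1 := Real.one_le_rpow hr hε
  have h2 : τ * ((n : ℝ) / ((i : ℝ) + 1)) ^ ε ≤ 1 * ((n : ℝ) / ((i : ℝ) + 1)) ^ ε := by gcongr
  have h3 := ho.norm_le hi
  have h4 := mul_le_mul_of_nonneg_left (by linarith :
    1 + τ * ((n : ℝ) / ((i : ℝ) + 1)) ^ ε ≤ 2 * ((n : ℝ) / ((i : ℝ) + 1)) ^ ε)
    (norm_nonneg (a (n - 1)))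
  linarith

/-- Average $a_j-a_i$ over $w_{n,\cdot}$ and insert the induction hypothesis. Replacing $|a_j|$ or
$|a_i|$ by $|a_{n-1}|$ costs a second-order term, the summand $\tau(1+4A^2/d^2)$. -/
theorem OscillationBelow.norm_sub_le_of_far (h : PositiveRecurrence d A D q) {a s : ℕ → ℂ}
    {τ ε : ℝ} {n : ℕ} (hτ : 0 ≤ τ) (hε : 0 ≤ ε) (hεd : ε ≤ d / 8)
    (ho : OscillationBelow D q a s τ ε n) {i : ℕ} (hi : i < n) (hn : 2 ≤ n) :
    ‖a n - a i‖ ≤ τ * ‖a (n - 1)‖ * ((n : ℝ) / ((i : ℝ) + 1)) ^ ε *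
      (1 - ε * (d / A * (1 / 2) * (1 / 3) ^ A) +
        2 * ε * (4 / d) * (4 * A ^ 2 / d ^ 2) / ((n : ℝ) / ((i : ℝ) + 1)) ^ (d / 2) +
        τ * (1 + 4 * A ^ 2 / d ^ 2)) + ‖s n‖ := by
  have hd := h.d_pos
  have hn' : (0 : ℝ) < n := by positivity
  set Z := ‖a (n - 1)‖
  set r : ℝ := (n : ℝ) / ((i : ℝ) + 1) with hr
  have hr1 : 1 ≤ r := by rw [hr, one_le_div (by positivity)]; exact_mod_cast hi
  have hrε : 1 ≤ r ^ ε := Real.one_le_rpow hr1 hε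
  set y : ℕ → ℝ := fun j => (n : ℝ) / ((j : ℝ) + 1) with hy
  have hy1 : ∀ j < n, 1 ≤ y j := fun j hj => by
    simp only [y]; rw [one_le_div (by positivity)]; exact_mod_cast hj
  have hone := h.sum_weight (le_refl n) (by omega)
  set Ψ : ℕ → ℝ := fun j => if i ≤ j then (((j : ℝ) + 1) / ((i : ℝ) + 1)) ^ ε
          else (((i : ℝ) + 1) / ((j : ℝ) + 1)) ^ ε with hΨ
  have key : ∀ j ∈ Finset.range n, ‖a j - a i‖ ≤
      τ * Z * (Ψ j + τ * (r ^ ε + y j ^ (d / 2))) := by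
    intro j hj
    have hj' := Finset.mem_range.1 hj
    have hyb : 0 ≤ y j ^ (d / 2) := by have := hy1 j hj'; positivity
    simp only [hΨ]
    split_ifs with hij
    · have h1 := ho.norm_sub_le j hj' i hij
      rw [norm_sub_rev] at h1
      have h2 := ho.norm_le hj'
      have e : y j ^ ε * (((j : ℝ) + 1) / ((i : ℝ) + 1)) ^ ε = r ^ ε := by
        rw [← Real.mul_rpow (by positivity) (by positivity)]
        congr 1
        simp only [hy, hr]; field_simp
      calc ‖a j - a i‖ ≤ τ * ‖a j‖ * (((j : ℝ) + 1) / ((i : ℝ) + 1)) ^ ε := h1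
        _ ≤ τ * (Z * (1 + τ * y j ^ ε)) * (((j : ℝ) + 1) / ((i : ℝ) + 1)) ^ ε := by gcongr
        _ = τ * Z * ((((j : ℝ) + 1) / ((i : ℝ) + 1)) ^ ε +
            τ * (y j ^ ε * (((j : ℝ) + 1) / ((i : ℝ) + 1)) ^ ε)) := by ring
        _ ≤ _ := by
          rw [e]
          gcongr
          linarith
    · have h1 := ho.norm_sub_le i hi j (by omega)
      have h2 := ho.norm_le hi
      have e : r ^ ε * (((i : ℝ) + 1) / ((j : ℝ) + 1)) ^ ε = y j ^ ε := by
        rw [← Real.mul_rpow (by positivity) (by positivity)]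
        congr 1
        simp only [hy, hr]; field_simp
      have h3 : y j ^ ε ≤ y j ^ (d / 2) :=
        Real.rpow_le_rpow_of_exponent_le (hy1 j hj') (by linarith)
      calc ‖a j - a i‖ ≤ τ * ‖a i‖ * (((i : ℝ) + 1) / ((j : ℝ) + 1)) ^ ε := h1
        _ ≤ τ * (Z * (1 + τ * r ^ ε)) * (((i : ℝ) + 1) / ((j : ℝ) + 1)) ^ ε := by gcongr
        _ = τ * Z * ((((i : ℝ) + 1) / ((j : ℝ) + 1)) ^ ε +
            τ * (r ^ ε * (((i : ℝ) + 1) / ((j : ℝ) + 1)) ^ ε)) := by ring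
        _ ≤ _ := by
          rw [e]
          gcongr
          linarith
  have hav : a n - a i = ∑ j ∈ Finset.range n, weight D q n j • (a j - a i) + s n := by
    simp only [smul_sub, Finset.sum_sub_distrib, ← Finset.sum_smul, hone, one_smul]
    conv_lhs => rw [average_of_le ho.average (le_refl n) (by omega)]
    ring
  have hsum := h.sum_weight_mul_ratio_rpow_le (i := i) hn hε hεd
  have hC := h.sum_weight_rpow_le n
  have hC0 : 0 ≤ 4 * A ^ 2 / d ^ 2 := by positivity
  calc ‖a n - a i‖ ≤ ∑ j ∈ Finset.range n, weight D q n j *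
        (τ * Z * (Ψ j + τ * (r ^ ε + y j ^ (d / 2)))) + ‖s n‖ := by
        rw [hav]
        refine (norm_add_le _ _).trans (add_le_add_left ((norm_sum_le _ _).trans
          (Finset.sum_le_sum fun j hj => ?_)) _)
        rw [norm_smul, Real.norm_of_nonneg (h.weight_nonneg _ _)]
        exact mul_le_mul_of_nonneg_left (key j hj) (h.weight_nonneg _ _)
    _ = τ * Z * (∑ j ∈ Finset.range n, weight D q n j * Ψ j +
          τ * (r ^ ε * ∑ j ∈ Finset.range n, weight D q n j +
            ∑ j ∈ Finset.range n, weight D q n j * y j ^ (d / 2))) + ‖s n‖ := by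
        congr 1
        rw [Finset.mul_sum, ← Finset.sum_add_distrib, Finset.mul_sum, ← Finset.sum_add_distrib,
          Finset.mul_sum]
        exact Finset.sum_congr rfl fun j _ => by ring
    _ ≤ τ * Z * (r ^ ε * (1 - ε * (d / A * (1 / 2) * (1 / 3) ^ A) +
        2 * ε * (4 / d) * (4 * A ^ 2 / d ^ 2) / r ^ (d / 2)) +
          τ * (r ^ ε * 1 + r ^ ε * (4 * A ^ 2 / d ^ 2))) + ‖s n‖ := by
        rw [hone]
        have : ∑ j ∈ Finset.range n, weight D q n j * y j ^ (d / 2) ≤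
            r ^ ε * (4 * A ^ 2 / d ^ 2) := hC.trans (by nlinarith)
        gcongr
    _ = _ := by ring

/-- A coupling argument: $a_n$ and $a_i$ are both averages, and a common part `v` of their weights
cancels in the difference. Only mass $1-\sum v$ remains to be compared by the induction hypothesis.
The excess of the ratio powers over $1$ adds a loss of order $\varepsilon$. -/
theorem OscillationBelow.norm_sub_le_of_near (h : PositiveRecurrence d A D q) {a s : ℕ → ℂ}
    {τ ε R : ℝ} {n : ℕ} (hτ : 0 ≤ τ) (hε : 0 ≤ ε) (hεd : ε ≤ d / 8) (hR : 1 ≤ R)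
    (ho : OscillationBelow D q a s τ ε n) {i : ℕ} (hi : i < n)
    (hiR : (n : ℝ) / ((i : ℝ) + 1) ≤ R) :
    ‖a n - a i‖ ≤ τ * ‖a (n - 1)‖ * (1 + τ) *
      (1 - d / (2 * A) / (2 * R) ^ A + ε * (4 / d) * (4 * A ^ 2 / d ^ 2) * (1 + 2 * R)) +
      ‖s n‖ + ‖s i‖ := by
  have hd := h.d_pos
  have hd1 := h.d_le_one
  have hA := h.A_pos
  have hA1 := h.one_le_A
  have hn := ho.one_le
  have hn' : (0 : ℝ) < n := by exact_mod_cast hn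
  set Z := ‖a (n - 1)‖
  set y : ℕ → ℝ := fun j => (n : ℝ) / ((j : ℝ) + 1) with hy
  have hy1 : ∀ j < n, 1 ≤ y j := fun j hj => by
    simp only [y]; rw [one_le_div (by positivity)]; exact_mod_cast hj
  -- Covers $i=0$, where the weight is the unit mass at index $0$ and the usual range is empty.
  set I := max i 1 with hI
  have hI1 : 1 ≤ I := by omega
  have hI0 : (0 : ℝ) < I := by exact_mod_cast hI1
  have hIn : I ≤ n := by omega
  have hnI : (n : ℝ) / I ≤ 2 * R := by
    have h1 : (n : ℝ) ≤ R * ((i : ℝ) + 1) := (div_le_iff₀ (by positivity)).1 hiR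
    have h2 : ((i : ℝ) + 1) ≤ 2 * I := by exact_mod_cast (by omega : i + 1 ≤ 2 * I)
    rw [div_le_iff₀ hI0]
    nlinarith
  have hQn := h.partialSum_pos hn
  have hQI := h.partialSum_pos hI1
  -- Half of the lower bound `le_weight` at $n$, restricted to $j<I$. Since $Q_i\le Q_n$ it also
  -- lies below $w_{i,\cdot}$, and the half keeps its mass at most $1/2$, so the remaining mass is
  -- positive.
  set v : ℕ → ℝ := fun j => if j < I then d / (2 * A) * (q j / partialSum q n) else 0 with hv
  have hV : ∑ j ∈ Finset.range n, v j = d / (2 * A) * (partialSum q I / partialSum q n) := by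
    simp only [hv]
    rw [← Finset.sum_subset (Finset.range_mono hIn) fun j _ hj => if_neg (by simpa using hj),
      Finset.sum_congr rfl fun j hj => if_pos (Finset.mem_range.1 hj), ← Finset.mul_sum,
      ← Finset.sum_div]
    rfl
  have hVlow : d / (2 * A) / (2 * R) ^ A ≤ ∑ j ∈ Finset.range n, v j := by
    rw [hV, div_eq_mul_one_div _ ((2 * R) ^ A)]
    refine mul_le_mul_of_nonneg_left ?_ (by positivity)
    rw [div_le_div_iff₀ (by positivity) hQn, one_mul]
    refine (h.partialSum_le_mul_rpow hI1 hIn).trans ?_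
    gcongr
  have hVup : ∑ j ∈ Finset.range n, v j ≤ 1 / 2 := by
    rw [hV]
    have e1 : partialSum q I / partialSum q n ≤ 1 := (div_le_one hQn).2 (h.partialSum_mono hIn)
    have e2 : d / (2 * A) ≤ 1 / 2 := by
      rw [div_le_div_iff₀ (by positivity) (by norm_num)]; linarith
    calc d / (2 * A) * (partialSum q I / partialSum q n) ≤ 1 / 2 * 1 := by gcongr
      _ = 1 / 2 := by norm_num
  have hv0 : ∀ j, 0 ≤ v j := fun j => by
    simp only [hv]; have := h.pos j; split_ifs <;> positivity
  have hhalf : d / (2 * A) ≤ d / A := by gcongr; linarith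
  have hvn : ∀ j ∈ Finset.range n, 0 ≤ weight D q n j - v j := fun j hj => by
    have h1 := h.le_weight (Finset.mem_range.1 hj)
    have := h.pos j
    have h2 : d / (2 * A) * (q j / partialSum q n) ≤ d / A * (q j / partialSum q n) := by gcongr
    simp only [hv]
    split_ifs
    · linarith
    · simpa using h.weight_nonneg n j
  have hvi : ∀ j ∈ Finset.range n, 0 ≤ weight D q i j - v j := fun j hj => by
    simp only [hv]
    split_ifs with hjI
    · rcases Nat.eq_zero_or_pos i with rfl | hi0
      · have hj0 : j = 0 := by simpa [hI] using hjI
        subst hj0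
        simp only [weight, if_true, h.zero]
        have e1 : 1 / partialSum q n ≤ 1 := (div_le_one hQn).2 (h.one_le_partialSum hn)
        have e2 : d / (2 * A) ≤ 1 := by
          rw [div_le_one (by positivity)]; linarith
        have : d / (2 * A) * (1 / partialSum q n) ≤ 1 * 1 := by gcongr
        linarith
      · have hIi : I = i := by omega
        have hji : j < i := by omega
        have h1 := h.le_weight hji
        have := h.pos j
        have := h.partialSum_pos (n := i) hi0
        have h2 : d / (2 * A) * (q j / partialSum q n) ≤ d / A * (q j / partialSum q i) := by
          gcongr
          exact h.partialSum_mono hi.le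
        linarith
    · simpa using h.weight_nonneg i j
  have hpair : ∀ k < n, ∀ j ≤ k, ‖a j - a k‖ ≤ τ * Z * (1 + τ) *
      (1 + ε * (4 / d) * y j ^ (d / 2)) := by
    intro k hk j hjk
    have h1 := ho.norm_sub_le k hk j hjk
    have h2 := ho.norm_le hk
    have e : y k ^ ε * (((k : ℝ) + 1) / ((j : ℝ) + 1)) ^ ε = y j ^ ε := by
      rw [← Real.mul_rpow (by positivity) (by positivity)]
      congr 1
      simp only [hy]; field_simp
    have h3 : (((k : ℝ) + 1) / ((j : ℝ) + 1)) ^ ε ≤ y j ^ ε := by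
      simp only [hy]
      gcongr
      exact_mod_cast hk
    have h4 := rpow_sub_one_le (hy1 j (by omega)) (β := d / 2) (ε := ε) (by positivity) hε
        (by linarith)
    have e4 : ε * (2 / (d / 2)) = ε * (4 / d) := by field_simp; ring
    rw [e4] at h4
    calc ‖a j - a k‖ ≤ τ * ‖a k‖ * (((k : ℝ) + 1) / ((j : ℝ) + 1)) ^ ε := h1
      _ ≤ τ * (Z * (1 + τ * y k ^ ε)) * (((k : ℝ) + 1) / ((j : ℝ) + 1)) ^ ε := by gcongr
      _ = τ * Z * ((((k : ℝ) + 1) / ((j : ℝ) + 1)) ^ ε +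
          τ * (y k ^ ε * (((k : ℝ) + 1) / ((j : ℝ) + 1)) ^ ε)) := by ring
      _ ≤ τ * Z * (y j ^ ε + τ * y j ^ ε) := by rw [e]; gcongr
      _ = τ * Z * (1 + τ) * y j ^ ε := by ring
      _ ≤ _ := by gcongr; linarith
  have hT : 0 ≤ τ * Z * (1 + τ) := by positivity
  have hcouple := norm_sum_smul_sub_sum_smul_le (Finset.range n)
    (x := fun j => weight D q n j - v j) (z := fun j => weight D q i j - v j)
    (e := fun j => ε * (4 / d) * y j ^ (d / 2)) (a := a)
    (m := 1 - ∑ j ∈ Finset.range n, v j) (T := τ * Z * (1 + τ)) (by linarith) hvn hvi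
    (by rw [Finset.sum_sub_distrib, h.sum_weight le_rfl hn])
    (by rw [Finset.sum_sub_distrib, h.sum_weight hi.le hn])
    (by
      intro j hj k hk
      have hj' := Finset.mem_range.1 hj
      have hk' := Finset.mem_range.1 hk
      have p1 : 0 ≤ ε * (4 / d) * y j ^ (d / 2) := by positivity
      have p2 : 0 ≤ ε * (4 / d) * y k ^ (d / 2) := by positivity
      rcases le_total j k with hjk | hjk
      · exact (hpair k hk' j hjk).trans (mul_le_mul_of_nonneg_left (by linarith) hT)
      · rw [norm_sub_rev]
        exact (hpair j hj' k hjk).trans (mul_le_mul_of_nonneg_left (by linarith) hT))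
  have hdiff : a n - a i = (∑ j ∈ Finset.range n, (weight D q n j - v j) • a j -
      ∑ j ∈ Finset.range n, (weight D q i j - v j) • a j) + (s n - s i) := by
    simp only [sub_smul, Finset.sum_sub_distrib]
    conv_lhs => rw [average_of_le ho.average (le_refl n) hn, average_of_le ho.average hi.le hn]
    ring
  have hCn := h.sum_weight_rpow_le n
  have hC4 : 1 ≤ 4 * A ^ 2 / d ^ 2 := by
    rw [one_le_div (by positivity)]; nlinarith
  have hrange : ∀ j ∈ Finset.range n, 0 ≤ y j ^ (d / 2) := fun j hj => by positivity
  have hS1 : ∑ j ∈ Finset.range n, (weight D q n j - v j) * (ε * (4 / d) * y j ^ (d / 2)) ≤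
      ε * (4 / d) * (4 * A ^ 2 / d ^ 2) := by
    calc _ ≤ ∑ j ∈ Finset.range n, ε * (4 / d) * (weight D q n j * y j ^ (d / 2)) := by
          refine Finset.sum_le_sum fun j hj => ?_
          have h1 : 0 ≤ v j * (ε * (4 / d) * y j ^ (d / 2)) :=
            mul_nonneg (hv0 j) (mul_nonneg (by positivity) (hrange j hj))
          linarith
      _ ≤ _ := by rw [← Finset.mul_sum]; gcongr
  have hCi : ∑ j ∈ Finset.range n, weight D q i j * y j ^ (d / 2) ≤
      (4 * A ^ 2 / d ^ 2) * (2 * R) := by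
    have h2R : ((n : ℝ) / I) ^ (d / 2) ≤ 2 * R := by
      have h1 : 1 ≤ (n : ℝ) / I := by rw [one_le_div hI0]; exact_mod_cast hIn
      calc ((n : ℝ) / I) ^ (d / 2) ≤ ((n : ℝ) / I) ^ (1 : ℝ) :=
            Real.rpow_le_rpow_of_exponent_le h1 (by linarith)
        _ ≤ 2 * R := by rwa [Real.rpow_one]
    have hred : ∑ j ∈ Finset.range n, weight D q i j * y j ^ (d / 2) =
        ∑ j ∈ Finset.range I, weight D q i j * y j ^ (d / 2) := by
      symm
      refine Finset.sum_subset (Finset.range_mono hIn) fun j _ hj => ?_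
      rw [weight_eq_zero (N := I) (by omega) hI1 (by simpa using hj), zero_mul]
    have hIsum : ∑ j ∈ Finset.range I, weight D q i j * ((I : ℝ) / ((j : ℝ) + 1)) ^ (d / 2) ≤
        4 * A ^ 2 / d ^ 2 := by
      rcases Nat.eq_zero_or_pos i with rfl | hi0
      · simpa [hI, weight] using hC4
      · have hIi : I = i := by omega
        rw [hIi]
        exact h.sum_weight_rpow_le i
    rw [hred]
    calc ∑ j ∈ Finset.range I, weight D q i j * y j ^ (d / 2)
        = (∑ j ∈ Finset.range I, weight D q i j * ((I : ℝ) / ((j : ℝ) + 1)) ^ (d / 2)) *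
            ((n : ℝ) / I) ^ (d / 2) := by
          rw [Finset.sum_mul]
          refine Finset.sum_congr rfl fun j _ => ?_
          rw [mul_assoc, ← Real.mul_rpow (by positivity) (by positivity)]
          congr 2
          simp only [hy]; field_simp
      _ ≤ (4 * A ^ 2 / d ^ 2) * (2 * R) := by gcongr
  have hS2 : ∑ j ∈ Finset.range n, (weight D q i j - v j) * (ε * (4 / d) * y j ^ (d / 2)) ≤
      ε * (4 / d) * ((4 * A ^ 2 / d ^ 2) * (2 * R)) := by
    calc _ ≤ ∑ j ∈ Finset.range n, ε * (4 / d) * (weight D q i j * y j ^ (d / 2)) := by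
          refine Finset.sum_le_sum fun j hj => ?_
          have h1 : 0 ≤ v j * (ε * (4 / d) * y j ^ (d / 2)) :=
            mul_nonneg (hv0 j) (mul_nonneg (by positivity) (hrange j hj))
          linarith
      _ ≤ _ := by rw [← Finset.mul_sum]; gcongr
  calc ‖a n - a i‖ ≤ _ + (‖s n‖ + ‖s i‖) := by
        rw [hdiff]
        exact (norm_add_le _ _).trans (add_le_add hcouple (_root_.norm_sub_le _ _))
    _ ≤ τ * Z * (1 + τ) * ((1 - d / (2 * A) / (2 * R) ^ A) +
          ε * (4 / d) * (4 * A ^ 2 / d ^ 2) + ε * (4 / d) * ((4 * A ^ 2 / d ^ 2) * (2 * R))) +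
          (‖s n‖ + ‖s i‖) := by gcongr
    _ = _ := by ring

end PositiveRecurrence
-- Closing the induction, and linear growth
set_option maxHeartbeats 1000000 in
/-- A sequence that is an average of its past up to relative errors `O(ρ)` varies slowly:
its relative oscillation between two indices is `O(ρ)` times a small power of their ratio. -/
theorem exists_oscillation_bound {d A C₁ ε₀ : ℝ} (hd : 0 < d) (hA : 1 ≤ A)
    (hC₁ : 0 < C₁) (hε₀ : 0 < ε₀) :
    ∃ ε B δ : ℝ, 0 < ε ∧ ε ≤ d / 8 ∧ 0 < B ∧ 0 < δ ∧ B * δ ≤ 1 / 8 ∧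
      ∀ D q : ℕ → ℝ, PositiveRecurrence d A D q → ∀ (a s : ℕ → ℂ) (ρ : ℝ), 0 ≤ ρ → ρ ≤ δ →
        s 0 = 0 →
        (∀ m, a m = ∑ j ∈ Finset.range (max m 1), weight D q m j • a j + s m) →
        (∀ n, 1 ≤ n → ∀ X : ℝ, 0 ≤ X →
          (∀ j < n, ‖a j‖ ≤ X * ((n : ℝ) / ((j : ℝ) + 1)) ^ ε₀) → ‖s n‖ ≤ C₁ * ρ * X) →
        ∀ i, ∀ j ≤ i, ‖a j - a i‖ ≤ B * ρ * ‖a i‖ * (((i : ℝ) + 1) / ((j : ℝ) + 1)) ^ ε := by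
  have hA0 : 0 < A := by linarith
  set C₂ : ℝ := 4 * A ^ 2 / d ^ 2 with hC₂
  have hC₂0 : 0 < C₂ := by positivity
  set c₁ : ℝ := d / A * (1 / 2) * (1 / 3) ^ A with hc₁
  have hc₁0 : 0 < c₁ := by positivity
  -- Threshold between far and near: beyond $R$ the loss is at most half the gain $\varepsilon c_1$.
  -- Both are proportional to $\varepsilon$, so $R$ can be fixed first, and $\varepsilon$ is then
  -- chosen small in terms of $R$ for the near case.
  set R : ℝ := max 2 ((4 * (4 / d) * C₂ / c₁) ^ (2 / d)) with hR
  have hR2 : 2 ≤ R := le_max_left _ _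
  have hRpow : 4 * (4 / d) * C₂ / c₁ ≤ R ^ (d / 2) := by
    have h1 : ((4 * (4 / d) * C₂ / c₁) ^ (2 / d)) ^ (d / 2) = 4 * (4 / d) * C₂ / c₁ := by
      rw [← Real.rpow_mul (by positivity)]
      have : 2 / d * (d / 2) = 1 := by field_simp
      rw [this, Real.rpow_one]
    rw [← h1]
    exact Real.rpow_le_rpow (by positivity) (le_max_right _ _) (by positivity)
  set κ : ℝ := d / (2 * A) / (2 * R) ^ A with hκ
  have hκ0 : 0 < κ := by positivity
  set ε : ℝ := min (min ε₀ (d / 8)) (κ / (2 * (4 / d) * C₂ * (1 + 2 * R))) with hε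
  have hεpos : 0 < ε := by positivity
  have hεε₀ : ε ≤ ε₀ := (min_le_left _ _).trans (min_le_left _ _)
  have hεd : ε ≤ d / 8 := (min_le_left _ _).trans (min_le_right _ _)
  have hεκ : ε * (4 / d) * C₂ * (1 + 2 * R) ≤ κ / 2 := by
    have h1 : ε ≤ κ / (2 * (4 / d) * C₂ * (1 + 2 * R)) := min_le_right _ _
    rw [le_div_iff₀ (by positivity)] at h1
    linarith
  set c : ℝ := min (min (ε * c₁ / 2) (κ / 2)) (1 / 2) with hc
  have hc0 : 0 < c := by positivity
  have hc_far : c ≤ ε * c₁ / 2 := (min_le_left _ _).trans (min_le_left _ _)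
  have hc_near : c ≤ κ / 2 := (min_le_left _ _).trans (min_le_right _ _)
  have hc_half : c ≤ 1 / 2 := min_le_right _ _
  -- The net gain is at least $c$ in both cases. The bound $\tau\le\eta$ keeps the second-order
  -- terms below $c/4$, and `B` is chosen so that the errors $s$ also cost at most $c/4$ of
  -- $\tau|a_{i-1}|$; a gain $c/2$ is left.
  set η : ℝ := c / (4 * (1 + C₂)) with hη
  have hη0 : 0 < η := by positivity
  have hηC : η * (1 + C₂) = c / 4 := by rw [hη]; field_simp
  have hηc : η ≤ c / 4 := by linarith [mul_pos hη0 hC₂0]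
  set B : ℝ := 8 * C₁ * (1 + 2 * R) / c with hB
  have hB0 : 0 < B := by positivity
  have hBc : B * c = 8 * C₁ * (1 + 2 * R) := by rw [hB]; field_simp
  refine ⟨ε, B, η / B, hεpos, hεd, hB0, by positivity, ?_, ?_⟩
  · rw [mul_div_cancel₀ _ hB0.ne']; linarith
  intro D q h a s ρ hρ hρδ hs0 hav hs
  set τ : ℝ := B * ρ with hτ
  have hτ0 : 0 ≤ τ := by positivity
  have hτη : τ ≤ η := by
    have := (le_div_iff₀ hB0).1 hρδ
    linarith
  have hτc : τ ≤ c / 4 := hτη.trans hηc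
  have hτC : τ * (1 + C₂) ≤ c / 4 := by rw [← hηC]; gcongr
  suffices H : ∀ n, 1 ≤ n → ∀ i < n, ∀ j ≤ i,
      ‖a j - a i‖ ≤ τ * ‖a i‖ * (((i : ℝ) + 1) / ((j : ℝ) + 1)) ^ ε from
    fun i j hj => H (i + 1) (by omega) i (by omega) j hj
  intro n hn
  induction n, hn using Nat.le_induction with
  | base =>
    intro i hi j hj
    have hji : j = i := by omega
    subst hji
    simp only [sub_self, norm_zero]
    positivity
  | succ n hn ih =>
    have ho : PositiveRecurrence.OscillationBelow D q a s τ ε n := ⟨hn, hs0, hav, ih⟩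
    intro i hi j hj
    rcases Nat.lt_or_ge i n with hin | hin
    · exact ih i hin j hj
    have hin' : i = n := by omega
    subst hin'
    rcases hj.eq_or_lt with rfl | hji
    · simp only [sub_self, norm_zero]
      positivity
    have hn' : (0 : ℝ) < i := by exact_mod_cast hn
    set Z := ‖a (i - 1)‖ with hZ
    have hZ0 : 0 ≤ Z := norm_nonneg _
    have hstep : ∀ k < i, ‖a i - a k‖ ≤
        τ * Z * ((i : ℝ) / ((k : ℝ) + 1)) ^ ε * (1 - c / 2) := by
      intro k hk
      set r : ℝ := (i : ℝ) / ((k : ℝ) + 1) with hr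
      have hr1 : 1 ≤ r := by rw [hr, one_le_div (by positivity)]; exact_mod_cast hk
      have hrε : 1 ≤ r ^ ε := Real.one_le_rpow hr1 hεpos.le
      have hsn : ‖s i‖ ≤ C₁ * ρ * (2 * Z) := by
        refine hs i hn _ (by positivity) fun l hl => ?_
        refine (ho.norm_le_two_mul (by linarith) hεpos.le hl).trans ?_
        have hy : 1 ≤ (i : ℝ) / ((l : ℝ) + 1) := by
          rw [one_le_div (by positivity)]; exact_mod_cast hl
        gcongr
      have hterm : C₁ * ρ * (2 * Z) * (1 + 2 * R) = τ * Z * (c / 4) := by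
        rw [hτ]
        linear_combination (-(ρ * Z / 4)) * hBc
      have hτZ : 0 ≤ τ * Z := by positivity
      rcases le_or_gt r R with hrR | hrR
      · have h1 : ‖a i - a k‖ ≤ τ * Z * (1 + τ) *
            (1 - κ + ε * (4 / d) * C₂ * (1 + 2 * R)) + ‖s i‖ + ‖s k‖ :=
          ho.norm_sub_le_of_near h hτ0 hεpos.le hεd (by linarith) hk hrR
        have hsk : ‖s k‖ ≤ C₁ * ρ * (2 * Z * (2 * R)) := by
          rcases Nat.eq_zero_or_pos k with rfl | hk0
          · rw [hs0, norm_zero]; positivity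
          refine hs k hk0 _ (by positivity) fun l hl => ?_
          refine (ho.norm_le_two_mul (by linarith) hεpos.le (hl.trans hk)).trans ?_
          have hk0' : (1 : ℝ) ≤ k := by exact_mod_cast hk0
          have hy : 1 ≤ (k : ℝ) / ((l : ℝ) + 1) := by
            rw [one_le_div (by positivity)]; exact_mod_cast hl
          have hik1 : 1 ≤ (i : ℝ) / k := by
            rw [one_le_div (by positivity)]; exact_mod_cast hk.le
          have hik : (i : ℝ) / k ≤ 2 * R := by
            rw [div_le_iff₀ (by positivity)]
            rw [hr, div_le_iff₀ (by positivity)] at hrR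
            calc (i : ℝ) ≤ R * ((k : ℝ) + 1) := hrR
              _ ≤ R * (k + k) := by gcongr
              _ = 2 * R * k := by ring
          have e : (i : ℝ) / ((l : ℝ) + 1) = (i / k) * (k / ((l : ℝ) + 1)) := by field_simp
          have h2 : ((i : ℝ) / k) ^ ε ≤ 2 * R := by
            calc ((i : ℝ) / k) ^ ε ≤ ((i : ℝ) / k) ^ (1 : ℝ) :=
                  Real.rpow_le_rpow_of_exponent_le hik1 (by linarith [h.d_le_one])
              _ ≤ 2 * R := by rwa [Real.rpow_one]
          have h3 : ((k : ℝ) / ((l : ℝ) + 1)) ^ ε ≤ ((k : ℝ) / ((l : ℝ) + 1)) ^ ε₀ :=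
            Real.rpow_le_rpow_of_exponent_le hy hεε₀
          rw [e, Real.mul_rpow (by positivity) (by positivity), ← mul_assoc]
          gcongr
        have h2 : (1 + τ) * (1 - κ + ε * (4 / d) * C₂ * (1 + 2 * R)) ≤ 1 - 3 * c / 4 := by
          have : (1 + τ) * (1 - κ + ε * (4 / d) * C₂ * (1 + 2 * R)) ≤ (1 + τ) * (1 - c) :=
            mul_le_mul_of_nonneg_left (by linarith) (by linarith)
          linarith [mul_nonneg hτ0 hc0.le]
        have h3 : ‖a i - a k‖ ≤ τ * Z * (1 - 3 * c / 4) + τ * Z * (c / 4) := by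
          have h4 := mul_le_mul_of_nonneg_left h2 hτZ
          have h5 : ‖s i‖ + ‖s k‖ ≤ τ * Z * (c / 4) := by
            rw [← hterm]
            linarith
          linarith
        calc ‖a i - a k‖ ≤ τ * Z * 1 * (1 - c / 2) := by linarith
          _ ≤ _ := by
            have : 0 ≤ 1 - c / 2 := by linarith
            gcongr
      · have hi2 : 2 ≤ i := by
          by_contra hcon
          have hi1 : i = 1 := by omega
          have hk0 : k = 0 := by omega
          rw [hr, hi1, hk0] at hrR
          norm_num at hrR
          linarith
        have h1 : ‖a i - a k‖ ≤ τ * Z * r ^ ε *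
            (1 - ε * c₁ + 2 * ε * (4 / d) * C₂ / r ^ (d / 2) + τ * (1 + C₂)) + ‖s i‖ :=
          ho.norm_sub_le_of_far h hτ0 hεpos.le hεd hk hi2
        have h2 : 2 * ε * (4 / d) * C₂ / r ^ (d / 2) ≤ ε * c₁ / 2 := by
          have hrp : 4 * (4 / d) * C₂ / c₁ ≤ r ^ (d / 2) :=
            hRpow.trans (Real.rpow_le_rpow (by linarith) hrR.le (by positivity))
          rw [div_le_iff₀ hc₁0] at hrp
          rw [div_le_iff₀ (by positivity)]
          linarith [mul_le_mul_of_nonneg_left hrp hεpos.le]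
        have h3 : 1 - ε * c₁ + 2 * ε * (4 / d) * C₂ / r ^ (d / 2) + τ * (1 + C₂) ≤
            1 - 3 * c / 4 := by linarith
        have h5 : ‖s i‖ ≤ τ * Z * r ^ ε * (c / 4) := by
          calc ‖s i‖ ≤ C₁ * ρ * (2 * Z) * 1 := by linarith
            _ ≤ C₁ * ρ * (2 * Z) * (1 + 2 * R) := by gcongr; linarith
            _ = τ * Z * 1 * (c / 4) := by rw [hterm]; ring
            _ ≤ _ := by gcongr
        have h4 := mul_le_mul_of_nonneg_left h3 (by positivity : 0 ≤ τ * Z * r ^ ε)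
        linarith
    -- The remaining factor $1-c/2\le1-\tau$ pays for replacing $|a_{i-1}|$ by $|a_i|$.
    have hZa : Z * (1 - τ) ≤ ‖a i‖ := by
      have h1 := hstep (i - 1) (by omega)
      have e : ((i - 1 : ℕ) : ℝ) + 1 = i := by rw [Nat.cast_sub hn]; simp
      rw [e, div_self hn'.ne', Real.one_rpow, mul_one] at h1
      have h2 := norm_sub_norm_le (a (i - 1)) (a i)
      rw [norm_sub_rev] at h2
      have h3 : τ * Z * (1 - c / 2) ≤ τ * Z * 1 := by gcongr; linarith
      linarith
    rw [norm_sub_rev]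
    calc ‖a i - a j‖ ≤ τ * Z * ((i : ℝ) / ((j : ℝ) + 1)) ^ ε * (1 - c / 2) := hstep j hji
      _ = τ * (Z * (1 - c / 2)) * ((i : ℝ) / ((j : ℝ) + 1)) ^ ε := by ring
      _ ≤ τ * ‖a i‖ * (((i : ℝ) + 1) / ((j : ℝ) + 1)) ^ ε := by
        have h1 : Z * (1 - c / 2) ≤ ‖a i‖ :=
          (mul_le_mul_of_nonneg_left (by linarith) hZ0).trans hZa
        gcongr
        linarith

/-- The oscillation bound is relative to the later term, so it must be inverted. Over one doubling
of the index the norm grows by at most $4/3$; halving $j$ repeatedly then gives at most linear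
growth. -/
theorem norm_le_of_oscillation_bound {a : ℕ → ℂ} {τ ε : ℝ} (hτ : τ ≤ 1 / 8)
    (hε1 : ε ≤ 1)
    (ha : ∀ i, ∀ j ≤ i, ‖a j - a i‖ ≤ τ * ‖a i‖ * (((i : ℝ) + 1) / ((j : ℝ) + 1)) ^ ε) (i : ℕ) :
    ∀ j, i ≤ j → ‖a j‖ ≤ 2 * (((j : ℝ) + 1) / ((i : ℝ) + 1)) * ‖a i‖ := by
  have hclose : ∀ k j : ℕ, k ≤ j → j + 1 ≤ 2 * (k + 1) → ‖a j‖ ≤ 4 / 3 * ‖a k‖ := by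
    intro k j hkj hj
    have h1 := ha j k hkj
    have h2 : (((j : ℝ) + 1) / ((k : ℝ) + 1)) ^ ε ≤ 2 := by
      have hr1 : 1 ≤ ((j : ℝ) + 1) / ((k : ℝ) + 1) := by
        rw [one_le_div (by positivity)]; exact_mod_cast (by omega : k + 1 ≤ j + 1)
      have hr2 : ((j : ℝ) + 1) / ((k : ℝ) + 1) ≤ 2 := by
        rw [div_le_iff₀ (by positivity)]; exact_mod_cast hj
      calc (((j : ℝ) + 1) / ((k : ℝ) + 1)) ^ ε ≤ (((j : ℝ) + 1) / ((k : ℝ) + 1)) ^ (1 : ℝ) :=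
            Real.rpow_le_rpow_of_exponent_le hr1 hε1
        _ ≤ 2 := by rwa [Real.rpow_one]
    have h3 : τ * ‖a j‖ * (((j : ℝ) + 1) / ((k : ℝ) + 1)) ^ ε ≤ 1 / 8 * ‖a j‖ * 2 := by gcongr
    have h4 := norm_sub_norm_le (a j) (a k)
    rw [norm_sub_rev] at h4
    linarith
  intro j
  induction j using Nat.strong_induction_on with
  | _ j ih =>
    intro hij
    have hi0 : (0 : ℝ) < (i : ℝ) + 1 := by positivity
    rcases le_or_gt (j + 1) (2 * (i + 1)) with hj | hj
    · have hr1 : 1 ≤ ((j : ℝ) + 1) / ((i : ℝ) + 1) := by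
        rw [one_le_div (by positivity)]; exact_mod_cast (by omega : i + 1 ≤ j + 1)
      refine (hclose i j hij hj).trans ?_
      gcongr
      linarith
    · have h1 := hclose (j / 2) j (by omega) (by omega)
      have h2 := ih (j / 2) (by omega) (by omega)
      have h3 : 4 / 3 * (((j / 2 : ℕ) : ℝ) + 1) ≤ (j : ℝ) + 1 := by
        have : (4 : ℝ) * (((j / 2 : ℕ) : ℝ) + 1) ≤ 3 * ((j : ℝ) + 1) := by
          exact_mod_cast (by omega : 4 * (j / 2 + 1) ≤ 3 * (j + 1))
        linarith
      calc ‖a j‖ ≤ 4 / 3 * (2 * ((((j / 2 : ℕ) : ℝ) + 1) / ((i : ℝ) + 1)) * ‖a i‖) := by linarith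
        _ = 2 * ((4 / 3 * (((j / 2 : ℕ) : ℝ) + 1)) / ((i : ℝ) + 1)) * ‖a i‖ := by ring
        _ ≤ _ := by gcongr

/-! ### Abel means at `exp (-1/n)` -/

namespace PositiveRecurrence

variable {d A : ℝ} {D q : ℕ → ℝ}

theorem le_rpow (h : PositiveRecurrence d A D q) (n : ℕ) : q n ≤ 2 * A * ((n : ℝ) + 1) ^ A := by
  have hA := h.A_pos
  have h1 := h.le_partialSum_div n
  have h2 := h.partialSum_le_mul_rpow (m := 1) (n := n + 1) le_rfl (by omega)
  have h3 : partialSum q 1 = 1 := by simp [partialSum, h.zero]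
  rw [h3, one_mul] at h2
  push_cast at h2
  rw [div_one] at h2
  refine h1.trans ((div_le_self ?_ ?_).trans ?_)
  · have := h.partialSum_pos (n := n + 1) (by omega)
    positivity
  · linarith [(Nat.cast_nonneg n : (0 : ℝ) ≤ n)]
  · gcongr

/-- The Abel means of `q` at `exp (-1/n)` are concentrated around the index `n`. -/
theorem exists_abel_concentration (d A : ℝ) :
    ∃ C : ℝ, 0 < C ∧ ∀ D q : ℕ → ℝ, PositiveRecurrence d A D q → ∀ n : ℕ, 1 ≤ n →
      Summable (fun j => q j * Real.exp (-1 / n) ^ j) ∧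
      Summable (fun j => q j * Real.exp (-1 / n) ^ j *
        ((((n : ℝ) + 1) / ((j : ℝ) + 1)) ^ (d / 2) + (((j : ℝ) + 1) / ((n : ℝ) + 1)) ^ 2)) ∧
      ∑' j, q j * Real.exp (-1 / n) ^ j *
        ((((n : ℝ) + 1) / ((j : ℝ) + 1)) ^ (d / 2) + (((j : ℝ) + 1) / ((n : ℝ) + 1)) ^ 2) ≤
        C * ∑' j, q j * Real.exp (-1 / n) ^ j := by
  -- In $e^{-r}\le K!/r^{A+3}$ with $r=(j+1)/(n+1)$, the power $A$ offsets the growth of $Q$, two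
  -- more powers offset the quadratic factor, and the last one leaves a tail of order $n/j^2$, which
  -- telescopes.
  set K : ℕ := ⌈A + 3⌉₊
  set C₃ : ℝ := A / d * (4 * A ^ 2 / d ^ 2 + 1) + 4 * A * (Nat.factorial K : ℝ) with hC₃
  -- The constant is named before any recurrence provides the signs of `d` and `A`, hence the
  -- absolute value.
  refine ⟨|C₃ * Real.exp 1| + 1, by positivity, fun D q h n hn => ?_⟩
  have hd := h.d_pos
  have hA := h.A_pos
  have hn' : (0 : ℝ) < n := by exact_mod_cast hn
  have hn1 : (0 : ℝ) < (n : ℝ) + 1 := by positivity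
  set x := Real.exp (-1 / n)
  have hx0 : 0 < x := Real.exp_pos _
  have hx1 : x < 1 := by
    rw [Real.exp_lt_one_iff]
    exact div_neg_of_neg_of_pos (by norm_num) hn'
  have hxj : ∀ j : ℕ, x ^ j = Real.exp (-(j / n)) := fun j => by
    simp only [x]
    rw [← Real.exp_nat_mul]
    congr 1
    ring
  have hQ := h.partialSum_pos (n := n + 1) (by omega)
  set b : ℕ → ℝ := fun j => (((n : ℝ) + 1) / ((j : ℝ) + 1)) ^ (d / 2) +
    (((j : ℝ) + 1) / ((n : ℝ) + 1)) ^ 2 with hb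
  have hb0 : ∀ j, 0 ≤ b j := fun j => by positivity
  have hterm0 : ∀ j, 0 ≤ q j * x ^ j * b j := fun j => by
    have := h.pos j; have := hb0 j; positivity
  -- Below $n+1$, `le_weight` bounds $q_j/Q_{n+1}$ by a multiple of the weights at $n+1$, whose
  -- negative moments are already known.
  have hhead : ∑ j ∈ Finset.range (n + 1), q j * x ^ j * b j ≤
      A / d * (4 * A ^ 2 / d ^ 2 + 1) * partialSum q (n + 1) := by
    have h1 := h.sum_weight_rpow_le (n + 1)
    have h2 := h.sum_weight (n := n + 1) le_rfl (by omega)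
    calc ∑ j ∈ Finset.range (n + 1), q j * x ^ j * b j
        ≤ ∑ j ∈ Finset.range (n + 1), A / d * partialSum q (n + 1) *
            (weight D q (n + 1) j * (((n + 1 : ℕ) : ℝ) / ((j : ℝ) + 1)) ^ (d / 2) +
              weight D q (n + 1) j) := by
          refine Finset.sum_le_sum fun j hj => ?_
          have hj' := Finset.mem_range.1 hj
          have hw := h.le_weight hj'
          have hqj := h.pos j
          have hxj1 : x ^ j ≤ 1 := pow_le_one₀ hx0.le hx1.le
          have hr : (((j : ℝ) + 1) / ((n : ℝ) + 1)) ^ 2 ≤ 1 := by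
            refine pow_le_one₀ (by positivity) ?_
            rw [div_le_one hn1]
            exact_mod_cast hj'
          have hq : q j ≤ A / d * partialSum q (n + 1) * weight D q (n + 1) j := by
            calc q j = A / d * partialSum q (n + 1) * (d / A * (q j / partialSum q (n + 1))) := by
                  field_simp
              _ ≤ _ := by gcongr
          push_cast
          calc q j * x ^ j * b j ≤ (A / d * partialSum q (n + 1) * weight D q (n + 1) j) * 1 *
                ((((n : ℝ) + 1) / ((j : ℝ) + 1)) ^ (d / 2) + 1) := by
                have := h.weight_nonneg (n + 1) j
                simp only [hb]
                gcongr
            _ = _ := by ring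
      _ = A / d * partialSum q (n + 1) *
            (∑ j ∈ Finset.range (n + 1),
              weight D q (n + 1) j * (((n + 1 : ℕ) : ℝ) / ((j : ℝ) + 1)) ^ (d / 2) + 1) := by
          rw [← Finset.mul_sum, Finset.sum_add_distrib, h2]
      _ ≤ A / d * partialSum q (n + 1) * (4 * A ^ 2 / d ^ 2 + 1) := by gcongr
      _ = _ := by ring
  have htail : ∀ k : ℕ, q (n + 1 + k) * x ^ (n + 1 + k) * b (n + 1 + k) ≤
      4 * A * (Nat.factorial K : ℝ) * partialSum q (n + 1) *
        (((n : ℝ) + 1) / ((n : ℝ) + 1 + k) - ((n : ℝ) + 1) / ((n : ℝ) + 1 + (k + 1))) := by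
    intro k
    set j := n + 1 + k with hj
    have hjc : (j : ℝ) = (n : ℝ) + 1 + k := by simp [hj]
    have hj1 : (0 : ℝ) < (j : ℝ) + 1 := by positivity
    set r : ℝ := ((j : ℝ) + 1) / ((n : ℝ) + 1) with hr
    have hr0 : 0 < r := by positivity
    have hr1 : 1 ≤ r := by
      rw [hr, one_le_div hn1, hjc]
      linarith [(Nat.cast_nonneg k : (0 : ℝ) ≤ k)]
    have hqj : q j ≤ 2 * A * (partialSum q (n + 1) * r ^ A) / ((j : ℝ) + 1) := by
      have h1 := h.le_partialSum_div j
      have h2 := h.partialSum_le_mul_rpow (m := n + 1) (n := j + 1) (by omega) (by omega)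
      push_cast at h2
      exact h1.trans (by gcongr)
    have hbj : b j ≤ 2 * r ^ 2 := by
      have h1 : (((n : ℝ) + 1) / ((j : ℝ) + 1)) ^ (d / 2) ≤ 1 := by
        refine Real.rpow_le_one (by positivity) ?_ (by positivity)
        rw [div_le_one hj1, hjc]
        linarith [(Nat.cast_nonneg k : (0 : ℝ) ≤ k)]
      have h2 : 1 ≤ r ^ 2 := one_le_pow₀ hr1
      simp only [hb]
      linarith
    have hxr : x ^ j ≤ (Nat.factorial K : ℝ) / (r ^ A * r ^ 3) := by
      have h1 : r ≤ j / n := by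
        rw [hr, div_le_div_iff₀ hn1 hn', hjc]
        nlinarith [(Nat.cast_nonneg k : (0 : ℝ) ≤ k)]
      have h2 : r ^ A * r ^ 3 ≤ r ^ K := by
        rw [← Real.rpow_natCast r 3, ← Real.rpow_add hr0, ← Real.rpow_natCast r K]
        exact Real.rpow_le_rpow_of_exponent_le hr1 (by push_cast; exact Nat.le_ceil _)
      have h3 := Real.pow_div_factorial_le_exp r hr0.le K
      rw [div_le_iff₀ (by positivity)] at h3
      rw [hxj, le_div_iff₀ (by positivity)]
      calc Real.exp (-(j / n)) * (r ^ A * r ^ 3) ≤ Real.exp (-r) * (Real.exp r * Nat.factorial K) := by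
            exact mul_le_mul (Real.exp_le_exp.2 (neg_le_neg h1)) (h2.trans h3) (by positivity)
              (Real.exp_pos _).le
        _ = Nat.factorial K := by
            rw [← mul_assoc, ← Real.exp_add]; simp
    have hqj0 := h.pos j
    calc q j * x ^ j * b j ≤ (2 * A * (partialSum q (n + 1) * r ^ A) / ((j : ℝ) + 1)) *
          ((Nat.factorial K : ℝ) / (r ^ A * r ^ 3)) * (2 * r ^ 2) := by
          have := hb0 j
          gcongr
      _ = 4 * A * (Nat.factorial K : ℝ) * partialSum q (n + 1) * (1 / (((j : ℝ) + 1) * r)) := by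
          field_simp
          norm_num
      _ ≤ _ := by
          refine mul_le_mul_of_nonneg_left ?_ (by positivity)
          have e : ((n : ℝ) + 1) / ((n : ℝ) + 1 + k) - ((n : ℝ) + 1) / ((n : ℝ) + 1 + (k + 1)) =
              ((n : ℝ) + 1) / ((j : ℝ) * ((j : ℝ) + 1)) := by
            rw [hjc]
            field_simp
            ring
          have e2 : 1 / (((j : ℝ) + 1) * r) = ((n : ℝ) + 1) / (((j : ℝ) + 1) * ((j : ℝ) + 1)) := by
            rw [hr]; field_simp
          have : (0 : ℝ) < j := by rw [hjc]; positivity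
          rw [e, e2]
          gcongr
          linarith
  have hpartial : ∀ N, ∑ j ∈ Finset.range N, q j * x ^ j * b j ≤ C₃ * partialSum q (n + 1) := by
    intro N
    calc ∑ j ∈ Finset.range N, q j * x ^ j * b j
        ≤ ∑ j ∈ Finset.range (n + 1 + N), q j * x ^ j * b j :=
          Finset.sum_le_sum_of_subset_of_nonneg (Finset.range_mono (by omega))
            fun j _ _ => hterm0 j
      _ = ∑ j ∈ Finset.range (n + 1), q j * x ^ j * b j +
          ∑ k ∈ Finset.range N, q (n + 1 + k) * x ^ (n + 1 + k) * b (n + 1 + k) :=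
          Finset.sum_range_add _ _ _
      _ ≤ A / d * (4 * A ^ 2 / d ^ 2 + 1) * partialSum q (n + 1) +
          4 * A * (Nat.factorial K : ℝ) * partialSum q (n + 1) * 1 := by
          refine add_le_add hhead ((Finset.sum_le_sum fun k _ => htail k).trans ?_)
          rw [← Finset.mul_sum]
          gcongr
          have ht := Finset.sum_range_sub' (fun k : ℕ => ((n : ℝ) + 1) / ((n : ℝ) + 1 + k)) N
          push_cast at ht
          rw [ht, add_zero, div_self hn1.ne']
          have : 0 ≤ ((n : ℝ) + 1) / ((n : ℝ) + 1 + N) := by positivity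
          linarith
      _ = _ := by rw [hC₃]; ring
  have hsum : Summable fun j => q j * x ^ j * b j := summable_of_sum_range_le hterm0 hpartial
  have hle := Real.tsum_le_of_sum_range_le hterm0 hpartial
  have hb1 : ∀ j, 1 ≤ b j := by
    intro j
    simp only [hb]
    rcases le_total ((j : ℝ) + 1) ((n : ℝ) + 1) with hjn | hjn
    · have h1 : 1 ≤ (((n : ℝ) + 1) / ((j : ℝ) + 1)) ^ (d / 2) :=
        Real.one_le_rpow (by rwa [one_le_div (by positivity)]) (by positivity)
      have h2 : 0 ≤ (((j : ℝ) + 1) / ((n : ℝ) + 1)) ^ 2 := by positivity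
      linarith
    · have h1 : 0 ≤ (((n : ℝ) + 1) / ((j : ℝ) + 1)) ^ (d / 2) := by positivity
      have h2 : 1 ≤ (((j : ℝ) + 1) / ((n : ℝ) + 1)) ^ 2 :=
        one_le_pow₀ (by rwa [one_le_div (by positivity)])
      linarith
  have hq0 : ∀ j, 0 ≤ q j * x ^ j := fun j => by have := h.pos j; positivity
  have hsum1 : Summable fun j => q j * x ^ j :=
    Summable.of_nonneg_of_le hq0 (fun j => le_mul_of_one_le_right (hq0 j) (hb1 j)) hsum
  refine ⟨hsum1, hsum, hle.trans ?_⟩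
  -- For $j\le n$ one has $x^j\ge e^{-1}$, so the Abel sum dominates the partial sum.
  have hlow : partialSum q (n + 1) ≤ Real.exp 1 * ∑' j, q j * x ^ j := by
    calc partialSum q (n + 1) ≤ ∑ j ∈ Finset.range (n + 1), Real.exp 1 * (q j * x ^ j) := by
          refine Finset.sum_le_sum fun j hj => ?_
          have hj' : (j : ℝ) ≤ n := by
            exact_mod_cast Nat.lt_succ_iff.1 (Finset.mem_range.1 hj)
          have hqj := h.pos j
          have : 1 ≤ Real.exp 1 * x ^ j := by
            rw [hxj, ← Real.exp_add]
            refine Real.one_le_exp ?_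
            have : (j : ℝ) / n ≤ 1 := (div_le_one hn').2 hj'
            linarith
          nlinarith
      _ ≤ _ := by
          rw [← Finset.mul_sum]
          gcongr
          exact hsum1.sum_le_tsum _ fun j _ => hq0 j
  have hT : 0 ≤ ∑' j, q j * x ^ j := tsum_nonneg hq0
  have hC0 : 0 ≤ C₃ := by positivity
  calc C₃ * partialSum q (n + 1) ≤ C₃ * (Real.exp 1 * ∑' j, q j * x ^ j) := by gcongr
    _ = (C₃ * Real.exp 1) * ∑' j, q j * x ^ j := by ring
    _ ≤ _ := by
      gcongr
      linarith [le_abs_self (C₃ * Real.exp 1)]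

end PositiveRecurrence
-- The mean value estimate for $M_n/p_n$
theorem exists_real_pCoeff (D : ℕ → ℝ) : ∃ q : ℕ → ℝ, ∀ n, pCoeff D n = (q n : ℂ) := by
  refine ⟨fun n => (pCoeff D n).re, fun n => ?_⟩
  induction n using Nat.strong_induction_on with
  | _ n ih =>
    rcases Nat.eq_zero_or_pos n with rfl | hn
    · simp [pCoeff, expCoeff_zero]
    have h : (n : ℂ) * pCoeff D n = ((∑ j ∈ Finset.range n, D (n - j) * (pCoeff D j).re : ℝ) : ℂ) := by
      unfold pCoeff
      rw [mul_expCoeff]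
      push_cast
      exact Finset.sum_congr rfl fun j hj => congrArg _ (ih j (Finset.mem_range.1 hj))
    have hn' : (n : ℂ) ≠ 0 := by exact_mod_cast hn.ne'
    have h2 : pCoeff D n =
        (((∑ j ∈ Finset.range n, D (n - j) * (pCoeff D j).re) / n : ℝ) : ℂ) := by
      rw [Complex.ofReal_div, ← h, Complex.ofReal_natCast]
      field_simp
    change pCoeff D n = ((pCoeff D n).re : ℂ)
    rw [h2, Complex.ofReal_re]

theorem exists_positiveRecurrence {d A : ℝ} (hd : 0 < d) (hd1 : d ≤ 1) (hA : 1 ≤ A) {D : ℕ → ℝ}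
    (hD : ∀ j, 1 ≤ j → d ≤ D j ∧ D j ≤ A) :
    ∃ q : ℕ → ℝ, PositiveRecurrence d A D q ∧ ∀ n, pCoeff D n = (q n : ℂ) := by
  obtain ⟨q, hq⟩ := exists_real_pCoeff D
  refine ⟨q, ⟨hd, hd1, hA, fun j hj => (hD j hj).1, fun j hj => (hD j hj).2, ?_, fun n => ?_⟩, hq⟩
  · have := hq 0
    rw [pCoeff, expCoeff_zero] at this
    exact_mod_cast this.symm
  · have h := mul_expCoeff (fun j => (D j : ℂ)) n
    have e : ∀ m, expCoeff (fun j => (D j : ℂ)) m = (q m : ℂ) := hq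
    simp only [e] at h
    exact_mod_cast h

/-- Keep the last summand of the averaged condition and use $n\le n^p$. This crude bound serves only
the convergence of power series in the disc. -/
theorem norm_sub_one_le {p ρ : ℝ} (hp : 1 ≤ p) (hρ : 0 ≤ ρ) {f : ℕ → ℂ}
    (hf : ∀ n : ℕ, ∑ k ∈ Finset.range n, ‖f (k + 1) - 1‖ ^ p ≤ n * ρ ^ p) {n : ℕ} (hn : 1 ≤ n) :
    ‖f n - 1‖ ≤ n * ρ := by
  have hp0 : 0 < p := by linarith
  have hn' : (1 : ℝ) ≤ n := by exact_mod_cast hn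
  have h1 : ‖f n - 1‖ ^ p ≤ ∑ k ∈ Finset.range n, ‖f (k + 1) - 1‖ ^ p := by
    have := Finset.single_le_sum (f := fun k => ‖f (k + 1) - 1‖ ^ p) (s := Finset.range n)
      (fun k _ => by positivity) (Finset.mem_range.2 (by omega : n - 1 < n))
    simpa [Nat.sub_add_cancel hn] using this
  rw [← Real.rpow_le_rpow_iff (norm_nonneg _) (by positivity) hp0,
    Real.mul_rpow (by positivity) hρ]
  refine h1.trans ((hf n).trans ?_)
  gcongr
  calc (n : ℝ) = (n : ℝ) ^ (1 : ℝ) := (Real.rpow_one _).symm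
    _ ≤ (n : ℝ) ^ p := Real.rpow_le_rpow_of_exponent_le hn' hp

theorem norm_mul_sub_one_div_le {A ρ : ℝ} (hA : 0 ≤ A) {D : ℕ → ℝ} {f : ℕ → ℂ}
    (hD : ∀ j, 1 ≤ j → |D j| ≤ A) (hf : ∀ n, 1 ≤ n → ‖f n - 1‖ ≤ n * ρ) {n : ℕ} (hn : 1 ≤ n) :
    ‖(D n : ℂ) * ((f n - 1) / (n : ℂ))‖ ≤ A * ρ := by
  have hn' : (0 : ℝ) < n := by exact_mod_cast hn
  rw [norm_mul, norm_div, Complex.norm_real, Real.norm_eq_abs, Complex.norm_natCast]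
  have : ‖f n - 1‖ / n ≤ ρ := by
    rw [div_le_iff₀ hn', mul_comm]
    exact hf n hn
  have := hD n hn
  gcongr

theorem summable_LTerm {A ρ : ℝ} (hA : 0 ≤ A) (hρ : 0 ≤ ρ) {D : ℕ → ℝ} {f : ℕ → ℂ}
    (hD : ∀ j, 1 ≤ j → |D j| ≤ A) (hf : ∀ n, 1 ≤ n → ‖f n - 1‖ ≤ n * ρ) {z : ℂ} (hz : ‖z‖ < 1) :
    Summable (LTerm D f z) := by
  have h := summable_norm_coeff_mul_pow (C := A * ρ) (k := 0)
    (c := fun n => if n = 0 then 0 else (D n : ℂ) * ((f n - 1) / (n : ℂ)))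
    (fun n => by
      rcases Nat.eq_zero_or_pos n with rfl | hn
      · simp; positivity
      · simpa [hn.ne'] using norm_mul_sub_one_div_le hA hD hf hn) hz
  refine ((summable_nat_add_iff 1).2 h.of_norm).congr fun n => ?_
  simp [LTerm]

theorem tsum_MCoeff_mul_pow {A ρ C : ℝ} {k : ℕ} (hA : 0 ≤ A) (hρ : 0 ≤ ρ) {D : ℕ → ℝ} {f : ℕ → ℂ}
    (hD : ∀ j, 1 ≤ j → |D j| ≤ A) (hf : ∀ n, 1 ≤ n → ‖f n - 1‖ ≤ n * ρ)
    (hp : ∀ n, ‖pCoeff D n‖ ≤ C * ((n : ℝ) + 1) ^ k)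
    (hM : ∀ n, ‖MCoeff D f n‖ ≤ C * ((n : ℝ) + 1) ^ k) {z : ℂ} (hz : ‖z‖ < 1) :
    ∑' n, MCoeff D f n * z ^ n = mFun D f z * ∑' n, pCoeff D n * z ^ n := by
  have hDf : ∀ n, 1 ≤ n → ‖(D n : ℂ)‖ ≤ A := fun n hn => by
    rw [Complex.norm_real, Real.norm_eq_abs]; exact hD n hn
  have hfn : ∀ n, 1 ≤ n → ‖f n‖ ≤ (1 + ρ) * ((n : ℝ) + 1) := fun n hn => by
    have h1 := hf n hn
    have h2 : ‖f n‖ ≤ ‖f n - 1‖ + 1 := by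
      simpa using norm_add_le (f n - 1) 1
    nlinarith [(Nat.cast_nonneg n : (0 : ℝ) ≤ n)]
  have hC : 0 ≤ C := by simpa using (norm_nonneg _).trans (hp 0)
  set C' : ℝ := max C (A * (1 + ρ)) with hC'
  have hup : ∀ n : ℕ, C * ((n : ℝ) + 1) ^ k ≤ C' * ((n : ℝ) + 1) ^ (k + 1) := fun n => by
    have : (1 : ℝ) ≤ (n : ℝ) + 1 := by linarith [(Nat.cast_nonneg n : (0 : ℝ) ≤ n)]
    have hle : C ≤ C' := le_max_left _ _
    gcongr
    · omega
  have hup2 : ∀ n : ℕ, A * ((1 + ρ) * ((n : ℝ) + 1)) ≤ C' * ((n : ℝ) + 1) ^ (k + 1) := fun n => by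
    have h1 : (1 : ℝ) ≤ (n : ℝ) + 1 := by linarith [(Nat.cast_nonneg n : (0 : ℝ) ≤ n)]
    have h2 : ((n : ℝ) + 1) ≤ ((n : ℝ) + 1) ^ (k + 1) := le_self_pow₀ h1 (by omega)
    have hle : A * (1 + ρ) ≤ C' := le_max_right _ _
    rw [← mul_assoc]
    gcongr
  have e1 := tsum_expCoeff_mul_pow (a := fun j => (D j : ℂ)) (C := C') (k := k + 1)
    (fun n hn => (hDf n hn).trans ((le_mul_of_one_le_right hA (by nlinarith
      [(Nat.cast_nonneg n : (0 : ℝ) ≤ n)])).trans (hup2 n)))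
    (fun n => (hp n).trans (hup n)) hz
  have e2 := tsum_expCoeff_mul_pow (a := fun j => (D j : ℂ) * f j) (C := C') (k := k + 1)
    (fun n hn => by
      rw [norm_mul]
      exact (mul_le_mul (hDf n hn) (hfn n hn) (norm_nonneg _) hA).trans (hup2 n))
    (fun n => (hM n).trans (hup n)) hz
  change ∑' n, MCoeff D f n * z ^ n = _ at e2
  change ∑' n, pCoeff D n * z ^ n = _ at e1
  rw [e1, e2, mFun, ← Complex.exp_add, ← (summable_LTerm hA hρ hD hf hz).tsum_add]
  · congr 1
    refine tsum_congr fun j => ?_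
    simp only [LTerm]
    ring
  · have h := summable_norm_coeff_mul_pow (C := A) (k := 0)
      (c := fun n => if n = 0 then 0 else (D n : ℂ) / (n : ℂ))
      (fun n => by
        rcases Nat.eq_zero_or_pos n with rfl | hn
        · simpa using hA
        · simp only [hn.ne', if_false, norm_div, Complex.norm_natCast, pow_zero, mul_one]
          exact (div_le_self (norm_nonneg _) (by exact_mod_cast hn)).trans (hDf n hn)) hz
    refine ((summable_nat_add_iff 1).2 h.of_norm).congr fun n => ?_
    simp

/-- The mean value estimate under the averaged condition `∑_{k ≤ n} |f_k - 1|^p ≤ n ρ^p`. -/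
theorem exists_mean_value_bound {d A p : ℝ} (hd : 0 < d) (hd1 : d ≤ 1) (hA : 1 ≤ A)
    (hp : 1 / d < p) :
    ∃ δ : ℝ, 0 < δ ∧ ∃ C : ℝ, 0 < C ∧ ∀ D : ℕ → ℝ, (∀ j, 1 ≤ j → d ≤ D j ∧ D j ≤ A) →
      ∀ (f : ℕ → ℂ) (ρ : ℝ), 0 ≤ ρ → ρ ≤ δ →
        (∀ n : ℕ, ∑ k ∈ Finset.range n, ‖f (k + 1) - 1‖ ^ p ≤ n * ρ ^ p) →
        (∀ z : ℂ, ‖z‖ < 1 → Summable (LTerm D f z)) ∧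
        ∀ n : ℕ, 1 ≤ n → ∃ r : ℂ, ‖r‖ ≤ C * ρ ∧
          MCoeff D f n / pCoeff D n =
            mFun D f ((Real.exp (-1 / (n : ℝ)) : ℝ) : ℂ) * (1 + r) := by
  have hA0 : 0 < A := by linarith
  have hp1 : 1 < p := lt_of_le_of_lt ((one_le_div hd).2 hd1) hp
  have hp0 : 0 < p := by linarith
  have hpp := Real.HolderConjugate.conjExponent hp1
  set p' := Real.conjExponent p with hp'
  have hp'0 : 0 < p' := hpp.symm.pos
  -- This is where $p>1/d$ enters: the two conditions are equivalent. Half of the slack goes to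
  -- `ε₀`, the growth exponent allowed in the bound for $s_n$.
  have hdp : (1 - d) * p' < 1 := by
    have h1 : p' = p / (p - 1) := rfl
    rw [h1, ← mul_div_assoc, div_lt_one (by linarith)]
    have := (div_lt_iff₀ hd).1 hp
    nlinarith
  set ε₀ : ℝ := (1 - (1 - d) * p') / (2 * p') with hε₀
  have hε₀0 : 0 < ε₀ := div_pos (by linarith) (by positivity)
  have hεp : (1 - d + ε₀) * p' < 1 := by
    have : ε₀ * p' = (1 - (1 - d) * p') / 2 := by rw [hε₀]; field_simp
    linarith
  set C₁ : ℝ := 2 * A ^ 2 / d * (1 / (1 - (1 - d + ε₀) * p')) ^ (1 / p') with hC₁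
  have hC₁0 : 0 < C₁ := by
    have : 0 < 1 - (1 - d + ε₀) * p' := by linarith
    positivity
  obtain ⟨ε, B, δ, hε, hεd, hB, hδ, hBδ, hosc⟩ := exists_oscillation_bound hd hA hC₁0 hε₀0
  obtain ⟨C₄, hC₄, habel⟩ := PositiveRecurrence.exists_abel_concentration d A
  refine ⟨min δ (1 / (4 * B * C₄)), by positivity, 4 * B * C₄, by positivity, ?_⟩
  intro D hD f ρ hρ hρδ hf
  have hρ1 : ρ ≤ δ := hρδ.trans (min_le_left _ _)
  have hρ2 : 2 * B * C₄ * ρ ≤ 1 / 2 := by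
    have := (le_div_iff₀ (by positivity)).1 (hρδ.trans (min_le_right _ _))
    linarith
  have hDabs : ∀ j, 1 ≤ j → |D j| ≤ A := fun j hj => by
    rw [abs_of_nonneg (hd.le.trans (hD j hj).1)]; exact (hD j hj).2
  have hfn : ∀ n, 1 ≤ n → ‖f n - 1‖ ≤ n * ρ := fun n hn => norm_sub_one_le hp1.le hρ hf hn
  refine ⟨fun z hz => summable_LTerm hA0.le hρ hDabs hfn hz, ?_⟩
  obtain ⟨q, h, hq⟩ := exists_positiveRecurrence hd hd1 hA hD
  have hqne : ∀ n, (q n : ℂ) ≠ 0 := fun n => by exact_mod_cast (h.pos n).ne'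
  set a : ℕ → ℂ := fun n => MCoeff D f n / (q n : ℂ) with ha
  have haM : ∀ n, MCoeff D f n = (q n : ℂ) * a n := fun n => by
    simp only [ha]; rw [mul_div_cancel₀ _ (hqne n)]
  have ha0 : a 0 = 1 := by simp [ha, MCoeff, expCoeff_zero, h.zero]
  set s : ℕ → ℂ := fun n => ∑ j ∈ Finset.range n, weight D q n j • ((f (n - j) - 1) * a j) with hs
  -- Split $\hat f = 1 + (\hat f-1)$ in the recurrence for $M_m$ and divide by $mp_m$.
  have hav : ∀ m, a m = ∑ j ∈ Finset.range (max m 1), weight D q m j • a j + s m := by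
    intro m
    rcases Nat.eq_zero_or_pos m with rfl | hm
    · simp [hs, weight]
    have hm' : (m : ℂ) ≠ 0 := by exact_mod_cast hm.ne'
    have hrec := mul_expCoeff (fun j => (D j : ℂ) * f j) m
    change (m : ℂ) * MCoeff D f m = ∑ j ∈ Finset.range m, (D (m - j) : ℂ) * f (m - j) * MCoeff D f j
      at hrec
    have e : max m 1 = m := by omega
    rw [e, hs, ← Finset.sum_add_distrib]
    have h1 : a m = ((m : ℂ) * MCoeff D f m) / (m * q m) := by
      simp only [ha]
      have := hqne m
      field_simp
    rw [h1, hrec, Finset.sum_div]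
    refine Finset.sum_congr rfl fun j hj => ?_
    rw [PositiveRecurrence.weight_of_lt (Finset.mem_range.1 hj), haM j, Complex.real_smul,
      Complex.real_smul]
    push_cast
    ring
  have hsb : ∀ n, 1 ≤ n → ∀ X : ℝ, 0 ≤ X →
      (∀ j < n, ‖a j‖ ≤ X * ((n : ℝ) / ((j : ℝ) + 1)) ^ ε₀) → ‖s n‖ ≤ C₁ * ρ * X := by
    intro n _ X hX hb
    refine le_trans ((norm_sum_le _ _).trans (Finset.sum_le_sum fun j _ => ?_))
      (h.sum_weight_mul_perturbation_le hpp hε₀0.le hεp (g := fun k => ‖f k - 1‖)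
        (fun k => norm_nonneg _) hρ hf hX hb)
    rw [norm_smul, norm_mul, Real.norm_of_nonneg (h.weight_nonneg _ _)]
  have hτ : B * ρ ≤ 1 / 8 := (mul_le_mul_of_nonneg_left hρ1 hB.le).trans hBδ
  have hab := hosc D q h a s ρ hρ hρ1 (by simp [hs]) hav hsb
  have hgrow := norm_le_of_oscillation_bound hτ (by linarith) hab
  intro n hn
  have hn1 : (0 : ℝ) < (n : ℝ) + 1 := by positivity
  have hn' : (0 : ℝ) < n := by exact_mod_cast hn
  obtain ⟨hsum1, hsum2, hle⟩ := habel D q h n hn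
  set x := Real.exp (-1 / (n : ℝ)) with hx
  have hx0 : 0 < x := Real.exp_pos _
  have hx1 : x < 1 := by
    rw [Real.exp_lt_one_iff]
    exact div_neg_of_neg_of_pos (by norm_num) hn'
  have hxn : ‖(x : ℂ)‖ < 1 := by
    rwa [Complex.norm_real, Real.norm_of_nonneg hx0.le]
  set S : ℝ := ∑' j, q j * x ^ j with hS
  have hS0 : 0 < S := by
    have h1 : q 0 * x ^ 0 ≤ S := hsum1.le_tsum 0 fun j _ => by
      have := h.pos j; positivity
    rw [h.zero] at h1
    linarith [pow_zero x]
  set k : ℕ := ⌈A⌉₊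
  have hqk : ∀ j : ℕ, q j ≤ 2 * A * ((j : ℝ) + 1) ^ k := fun j => by
    refine (h.le_rpow j).trans ?_
    rw [← Real.rpow_natCast]
    have : (1 : ℝ) ≤ (j : ℝ) + 1 := by linarith [(Nat.cast_nonneg j : (0 : ℝ) ≤ j)]
    gcongr
    exact Nat.le_ceil _
  have haj : ∀ j : ℕ, ‖a j‖ ≤ 2 * ((j : ℝ) + 1) := fun j => by
    simpa [ha0] using hgrow 0 j (by omega)
  have hMk : ∀ j : ℕ, ‖MCoeff D f j‖ ≤ 4 * A * ((j : ℝ) + 1) ^ (k + 1) := fun j => by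
    rw [haM, norm_mul, Complex.norm_real, Real.norm_of_nonneg (h.pos j).le]
    calc q j * ‖a j‖ ≤ 2 * A * ((j : ℝ) + 1) ^ k * (2 * ((j : ℝ) + 1)) :=
          mul_le_mul (hqk j) (haj j) (norm_nonneg _) (by positivity)
      _ = _ := by ring
  have hpk : ∀ j : ℕ, ‖pCoeff D j‖ ≤ 4 * A * ((j : ℝ) + 1) ^ (k + 1) := fun j => by
    rw [hq, Complex.norm_real, Real.norm_of_nonneg (h.pos j).le]
    refine (hqk j).trans ?_
    have : (1 : ℝ) ≤ (j : ℝ) + 1 := by linarith [(Nat.cast_nonneg j : (0 : ℝ) ≤ j)]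
    gcongr
    · norm_num
    · omega
  have hgen := tsum_MCoeff_mul_pow hA0.le hρ hDabs hfn hpk hMk hxn
  have hpS : ∑' j, pCoeff D j * (x : ℂ) ^ j = (S : ℂ) := by
    rw [hS, Complex.ofReal_tsum]
    refine tsum_congr fun j => ?_
    rw [hq]
    push_cast
    rfl
  rw [hpS] at hgen
  set m := mFun D f (x : ℂ) with hm
  have hm0 : m ≠ 0 := Complex.exp_ne_zero _
  have hterm : ∀ j, ‖(MCoeff D f j * (x : ℂ) ^ j - a n * ((q j * x ^ j : ℝ) : ℂ))‖ ≤
      2 * B * ρ * ‖a n‖ * (q j * x ^ j * ((((n : ℝ) + 1) / ((j : ℝ) + 1)) ^ (d / 2) +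
        (((j : ℝ) + 1) / ((n : ℝ) + 1)) ^ 2)) := by
    intro j
    have hj1 : (0 : ℝ) < (j : ℝ) + 1 := by positivity
    have hqx : 0 ≤ q j * x ^ j := by have := h.pos j; positivity
    have e : MCoeff D f j * (x : ℂ) ^ j - a n * ((q j * x ^ j : ℝ) : ℂ) =
        ((q j * x ^ j : ℝ) : ℂ) * (a j - a n) := by
      rw [haM]; push_cast; ring
    have hkey : ‖a j - a n‖ ≤ 2 * B * ρ * ‖a n‖ * ((((n : ℝ) + 1) / ((j : ℝ) + 1)) ^ (d / 2) +
        (((j : ℝ) + 1) / ((n : ℝ) + 1)) ^ 2) := by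
      have hp1 : 0 ≤ (((n : ℝ) + 1) / ((j : ℝ) + 1)) ^ (d / 2) := by positivity
      have hp2 : 0 ≤ (((j : ℝ) + 1) / ((n : ℝ) + 1)) ^ 2 := by positivity
      have hBn : 0 ≤ B * ρ * ‖a n‖ := by positivity
      rcases le_total j n with hjn | hjn
      · have hr : 1 ≤ ((n : ℝ) + 1) / ((j : ℝ) + 1) := by
          rw [one_le_div hj1]; exact_mod_cast Nat.succ_le_succ hjn
        have h2 : (((n : ℝ) + 1) / ((j : ℝ) + 1)) ^ ε ≤ (((n : ℝ) + 1) / ((j : ℝ) + 1)) ^ (d / 2) :=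
          Real.rpow_le_rpow_of_exponent_le hr (by linarith)
        calc ‖a j - a n‖ ≤ B * ρ * ‖a n‖ * (((n : ℝ) + 1) / ((j : ℝ) + 1)) ^ ε := hab n j hjn
          _ ≤ B * ρ * ‖a n‖ * (2 * ((((n : ℝ) + 1) / ((j : ℝ) + 1)) ^ (d / 2) +
                (((j : ℝ) + 1) / ((n : ℝ) + 1)) ^ 2)) :=
              mul_le_mul_of_nonneg_left (by linarith) hBn
          _ = _ := by ring
      -- For $j\ge n$ the oscillation is relative to $|a_j|$. Linear growth returns it to $|a_n|$ at
      -- the price of one factor $r$, whence the square in the Abel moment.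
      · set r := ((j : ℝ) + 1) / ((n : ℝ) + 1) with hr
        have hr1 : 1 ≤ r := by
          rw [hr, one_le_div hn1]; exact_mod_cast Nat.succ_le_succ hjn
        have h2 : r ^ ε ≤ r := by
          calc r ^ ε ≤ r ^ (1 : ℝ) := Real.rpow_le_rpow_of_exponent_le hr1 (by linarith)
            _ = r := Real.rpow_one r
        rw [norm_sub_rev]
        calc ‖a n - a j‖ ≤ B * ρ * ‖a j‖ * r ^ ε := hab j n hjn
          _ ≤ B * ρ * (2 * r * ‖a n‖) * r := by
              have := hgrow n j hjn
              gcongr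
          _ = 2 * B * ρ * ‖a n‖ * r ^ 2 := by ring
          _ ≤ _ := mul_le_mul_of_nonneg_left (by linarith) (by positivity)
    rw [e, norm_mul, Complex.norm_real, Real.norm_of_nonneg hqx]
    calc q j * x ^ j * ‖a j - a n‖ ≤ q j * x ^ j * _ := mul_le_mul_of_nonneg_left hkey hqx
      _ = _ := by ring
  -- By the generating function identity, $(m-a_n)S=\sum_j q_jx^j(a_j-a_n)$.
  have hdiff : ‖m - a n‖ ≤ 2 * B * C₄ * ρ * ‖a n‖ := by
    have h1 : (m - a n) * (S : ℂ) =
        ∑' j, (MCoeff D f j * (x : ℂ) ^ j - a n * ((q j * x ^ j : ℝ) : ℂ)) := by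
      rw [((summable_norm_coeff_mul_pow hMk hxn).of_norm).tsum_sub
        ((Complex.summable_ofReal.2 hsum1).mul_left _), hgen, tsum_mul_left, ← Complex.ofReal_tsum]
      ring
    have h2 := tsum_of_norm_bounded (hsum2.mul_left (2 * B * ρ * ‖a n‖)).hasSum hterm
    rw [← h1, norm_mul, Complex.norm_real, Real.norm_of_nonneg hS0.le, tsum_mul_left] at h2
    have h3 : ‖m - a n‖ * S ≤ (2 * B * C₄ * ρ * ‖a n‖) * S := by
      calc ‖m - a n‖ * S ≤ 2 * B * ρ * ‖a n‖ * (C₄ * S) :=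
            h2.trans (mul_le_mul_of_nonneg_left hle (by positivity))
        _ = _ := by ring
    exact le_of_mul_le_mul_right h3 hS0
  refine ⟨a n / m - 1, ?_, ?_⟩
  · have hm0' : 0 < ‖m‖ := norm_pos_iff.2 hm0
    have e : a n / m - 1 = (a n - m) / m := by field_simp
    rw [e, norm_div, norm_sub_rev, div_le_iff₀ hm0']
    -- The second bound on $\delta$ makes the relative error at most $1/2$, so it can be expressed
    -- relative to $m$.
    have h1 : ‖a n‖ ≤ 2 * ‖m‖ := by
      have h2 := norm_sub_norm_le (a n) m
      rw [norm_sub_rev] at h2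
      have h3 : 2 * B * C₄ * ρ * ‖a n‖ ≤ 1 / 2 * ‖a n‖ := by gcongr
      linarith
    calc ‖m - a n‖ ≤ 2 * B * C₄ * ρ * ‖a n‖ := hdiff
      _ ≤ 2 * B * C₄ * ρ * (2 * ‖m‖) := by gcongr
      _ = _ := by ring
  · rw [hq]
    change a n = _
    field_simp
    ring

/-! ### From `rho` to the averaged condition, and the conclusion -/

/-- For $k\le n$ one has $1\le n/k$, so the weighted series dominates the plain average. The
averaged condition is what the finite and infinite exponents have in common. -/
theorem sum_norm_rpow_le_of_rho {f : ℕ → ℂ} {p : ℝ≥0∞} (hp0 : p ≠ 0) (hp : p ≠ ∞)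
    (hf : rho f p ≠ ∞) (n : ℕ) :
    ∑ k ∈ Finset.range n, ‖f (k + 1) - 1‖ ^ p.toReal ≤ n * (rho f p).toReal ^ p.toReal := by
  have hpr : 0 < p.toReal := ENNReal.toReal_pos hp0 hp
  have h1 : rho f p ^ p.toReal =
      ∑' j : ℕ, ‖f (j + 1) - 1‖ₑ ^ p.toReal / ((j + 1 : ℕ) : ℝ≥0∞) := by
    rw [rho, if_neg hp, ← ENNReal.rpow_mul, one_div_mul_cancel hpr.ne', ENNReal.rpow_one]
  have h2 : ∑ k ∈ Finset.range n, ‖f (k + 1) - 1‖ₑ ^ p.toReal ≤ n * rho f p ^ p.toReal := by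
    rw [h1]
    calc ∑ k ∈ Finset.range n, ‖f (k + 1) - 1‖ₑ ^ p.toReal
        ≤ ∑ k ∈ Finset.range n,
            (n : ℝ≥0∞) * (‖f (k + 1) - 1‖ₑ ^ p.toReal / ((k + 1 : ℕ) : ℝ≥0∞)) := by
          refine Finset.sum_le_sum fun k hk => ?_
          have hk' : ((k + 1 : ℕ) : ℝ≥0∞) ≤ n := by exact_mod_cast Finset.mem_range.1 hk
          calc ‖f (k + 1) - 1‖ₑ ^ p.toReal
              = ((k + 1 : ℕ) : ℝ≥0∞) * (‖f (k + 1) - 1‖ₑ ^ p.toReal / ((k + 1 : ℕ) : ℝ≥0∞)) :=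
                (ENNReal.mul_div_cancel (by exact_mod_cast Nat.succ_ne_zero k)
                  (ENNReal.natCast_ne_top _)).symm
            _ ≤ _ := by gcongr
      _ = n * ∑ k ∈ Finset.range n, (‖f (k + 1) - 1‖ₑ ^ p.toReal / ((k + 1 : ℕ) : ℝ≥0∞)) := by
          rw [Finset.mul_sum]
      _ ≤ _ := by
          gcongr
          exact ENNReal.sum_le_tsum _
  have hfin : (n : ℝ≥0∞) * rho f p ^ p.toReal ≠ ∞ :=
    ENNReal.mul_ne_top (ENNReal.natCast_ne_top _) (ENNReal.rpow_ne_top_of_nonneg hpr.le hf)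
  have h3 := ENNReal.toReal_mono hfin h2
  rw [ENNReal.toReal_sum fun k _ => ENNReal.rpow_ne_top_of_nonneg hpr.le enorm_ne_top,
    ENNReal.toReal_mul, ← ENNReal.toReal_rpow, ENNReal.toReal_natCast] at h3
  simpa [← ENNReal.toReal_rpow] using h3

theorem sum_norm_rpow_le_of_rho_top {f : ℕ → ℂ} (hf : rho f ∞ ≠ ∞) {p : ℝ} (hp : 0 ≤ p) (n : ℕ) :
    ∑ k ∈ Finset.range n, ‖f (k + 1) - 1‖ ^ p ≤ n * (rho f ∞).toReal ^ p := by
  have h1 : ∀ k, ‖f (k + 1) - 1‖ ≤ (rho f ∞).toReal := fun k => by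
    have h2 : ‖f (k + 1) - 1‖ₑ ≤ rho f ∞ := by
      rw [rho, if_pos rfl]
      exact le_iSup (fun j : ℕ => ‖f (j + 1) - 1‖ₑ) k
    simpa using ENNReal.toReal_mono hf h2
  calc ∑ k ∈ Finset.range n, ‖f (k + 1) - 1‖ ^ p
      ≤ ∑ k ∈ Finset.range n, (rho f ∞).toReal ^ p :=
        Finset.sum_le_sum fun k _ => Real.rpow_le_rpow (norm_nonneg _) (h1 k) hp
    _ = _ := by simp

end MeanValue

theorem mainTheorem7 (dm dp : ℝ) (hdm : 0 < dm) (p : ℝ≥0∞)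
    (hp : ENNReal.ofReal (max 1 (1 / dm)) < p) :
    ∃ δ : ℝ, 0 < δ ∧ ∃ C : ℝ, 0 < C ∧
      ∀ d : ℕ → ℝ, (∀ j : ℕ, 1 ≤ j → dm ≤ d j ∧ d j ≤ dp) →
      ∀ f : ℕ → ℂ, MeanValue.rho f p ≤ ENNReal.ofReal δ →
        (∀ z : ℂ, ‖z‖ < 1 → Summable (MeanValue.LTerm d f z)) ∧
        ∀ n : ℕ, 1 ≤ n →
          ∃ r : ℂ, ‖r‖ ≤ C * (MeanValue.rho f p).toReal ∧
            MeanValue.MCoeff d f n / MeanValue.pCoeff d n =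
              MeanValue.mFun d f ((Real.exp (-1 / (n : ℝ)) : ℝ) : ℂ) * (1 + r) := by
  -- Lowering $d^-$ to at most $1$ and raising $d^+$ to at least $1$ loses nothing:
  -- $p>\max\{1,1/d^-\}$ is exactly $p>1/\min\{d^-,1\}$.
  have hmin : 0 < min dm 1 := lt_min hdm one_pos
  have hmax : 1 / min dm 1 ≤ max 1 (1 / dm) := by
    rcases min_choice dm 1 with h | h <;> rw [h]
    · exact le_max_right _ _
    · simp
  obtain ⟨p₀, hp₀, hsum⟩ : ∃ p₀ : ℝ, 1 / min dm 1 < p₀ ∧ ∀ f : ℕ → ℂ, MeanValue.rho f p ≠ ∞ →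
      ∀ n : ℕ, ∑ k ∈ Finset.range n, ‖f (k + 1) - 1‖ ^ p₀ ≤
        n * (MeanValue.rho f p).toReal ^ p₀ := by
    rcases eq_or_ne p ∞ with rfl | hpt
    -- For $p=\infty$ a uniform bound implies the averaged condition for every finite exponent, so
    -- any one above the threshold will do.
    · exact ⟨1 / min dm 1 + 1, by linarith, fun f hf n =>
        MeanValue.sum_norm_rpow_le_of_rho_top hf (by positivity) n⟩
    · refine ⟨p.toReal, hmax.trans_lt ?_, fun f hf n =>
        MeanValue.sum_norm_rpow_le_of_rho (ne_bot_of_gt hp) hpt hf n⟩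
      exact (ENNReal.ofReal_lt_iff_lt_toReal (by positivity) hpt).1 hp
  obtain ⟨δ, hδ, C, hC, H⟩ := MeanValue.exists_mean_value_bound hmin (min_le_right _ _)
    (le_max_right dp 1) hp₀
  refine ⟨δ, hδ, C, hC, fun d hd f hf => ?_⟩
  have hf' : MeanValue.rho f p ≠ ∞ := ne_top_of_le_ne_top ENNReal.ofReal_ne_top hf
  exact H d (fun j hj => ⟨(min_le_left _ _).trans (hd j hj).1, (hd j hj).2.trans (le_max_left _ _)⟩)
    f _ ENNReal.toReal_nonneg (ENNReal.toReal_le_of_le_ofReal hδ.le hf) (hsum f hf')
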